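/- **Theorem 2.2 (Davies–Gaffney–Grigor'yan).** Let $X$ be a discrete set and $m : X \to (0,\infty)$; write $\ell^2=\ell^2(X,m)$ for the complex Hilbert space with inner product $\langle f,g\rangle=\sum_{x} m(x) f(x)\overline{g(x)}$ and $C_c(X)$ for the finitely supported functions $X\to\mathbb C$. Let $(b,o,c)$ be a magnetic Schrödinger graph over $(X,m)$: $b : X\times X\to[0,\infty)$ is symmetric, vanishes on the diagonal and satisfies $\sum_y b(x,y)<\infty$ for all $x$; $o : X\times X\to\{z\in\mathbb C : |z|=1\}$ satisfies $o(x,y)=\overline{o(y,x)}$; and $c : X\to\mathbb R$. On $C_c(X)$ let $$Q(\varphi,\psi)=\frac12\sum_{x,y} b(x,y)\,\big(\varphi(x)-o(x,y)\varphi(y)\big)\overline{\big(\psi(x)-o(x,y)\psi(y)\big)}+\sum_x c(x)\varphi(x)\overline{\psi(x)} .$$ Assume that $Q$ is positive, i.e. $Q(\varphi,\varphi)\ge 0$ for all $\varphi\in C_c(X)$, and closable on $\ell^2$. Let $H$ be the positive self-adjoint operator on $\ell^2$ associated with the closure of $Q$, let $\lambda_2=\inf\sigma(H)$, and let $p_t(x,y)=\langle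 e^{-tH}1_x,1_y\rangle/(m(x)m(y))$ be the heat kernel. Let $d : X\times X\to[0,\infty]$ be an intrinsic metric, i.e. a pseudo metric (possibly with value $\infty$) such that $\sum_y b(x,y)\,d(x,y)^2\le m(x)$ for all $x\in X$, and assume that its jump size $s=\sup\{d(x,y): b(x,y)>0\}$ satisfies $0<s<\infty$. For $A,B\subseteq X$ let $d(A,B)=\inf_{x\in A,\,y\in B}d(x,y)$ (with $\inf\emptyset=\infty$), and let $$\zeta(r)=r\,\mathrm{arcsinh}(r)-\sqrt{1+r^2}+1,\qquad r\ge 0,\qquad \zeta(\infty)=\infty,\quad e^{-\infty}=0 .$$ Then for all $t>0$ and all $f,g\in\ell^2$ with supports $A=\operatorname{supp} f$ and $B=\operatorname{supp} g$, $$|\langle e^{-tH}f,g\rangle|\le \exp\Big(-\lambda_2 t-\frac{t}{s^2}\,\zeta\Big(\frac{s\,d(A,B)}{t}\Big)\Big)\,\|f\|_2\,\|g\|_2 .$$ Moreover, for all $t>0$ and all $x,y\in X$, $$|p_t(x,y)|\le \frac{1}{\sqrt{m(x)m(y)}}\exp\Big(-\lambda_2 t-\frac{t}{s^2}\,\zeta\Big(\frac{s\,d(x,y)}{t}\Big)\Big).$$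 -/

import Mathlib

open MeasureTheory Filter Topology
open scoped ENNReal

noncomputable section

namespace MagneticSchrodinger

/-! ### Sesquilinear forms and unbounded operators in a complex Hilbert space

Throughout, `V` is a complex vector space, `ι : V → E` its inclusion into the Hilbert space `E`, and
`q : V → V → ℂ` a positive sesquilinear form with domain `V`, linear in its first argument.
Mathlib's inner product `inner ℂ u v` is conjugate linear in `u`, so the inner product `⟨u, v⟩` which
is linear in `u` is `inner ℂ v u`. -/

section Forms

variable {E : Type*} [NormedAddCommGroup E] [InnerProductSpace ℂ E]
variable {V : Type*} [AddCommGroup V]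

/-- The sequence `φ` in the form domain is Cauchy with respect to the form `q` and converges to `f`
in the Hilbert space. -/
def FormTendsto (ι : V → E) (q : V → V → ℂ) (φ : ℕ → V) (f : E) : Prop :=
  Tendsto (fun n => ι (φ n)) atTop (𝓝 f) ∧
    Tendsto (fun p : ℕ × ℕ => q (φ p.1 - φ p.2) (φ p.1 - φ p.2)) atTop (𝓝 0)

/-- Closability: if `φ n → 0` in the Hilbert space and `φ` is `q`-Cauchy, then `q (φ n) → 0`. -/
def FormClosable (ι : V → E) (q : V → V → ℂ) : Prop :=
  ∀ φ : ℕ → V, FormTendsto ι q φ 0 → Tendsto (fun n => q (φ n) (φ n)) atTop (𝓝 0)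

/-- The domain `D(Q)` of the closure of the form. -/
def closureDomain (ι : V → E) (q : V → V → ℂ) : Set E :=
  {f | ∃ φ : ℕ → V, FormTendsto ι q φ f}

open Classical in
/-- The closure of the form: `Q(f, g) = lim q (φ n) (ψ n)` with `φ`, `ψ` any `q`-Cauchy sequences
converging to `f`, `g` (the limit exists and does not depend on the sequences when `q` is positive
and closable). It is `0` by convention outside `D(Q) × D(Q)`. -/
def closureForm (ι : V → E) (q : V → V → ℂ) (f g : E) : ℂ :=
  if h : f ∈ closureDomain ι q ∧ g ∈ closureDomain ι q then
    limUnder atTop (fun n => q (h.1.choose n) (h.2.choose n))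
  else 0

/-- The graph of the operator `H` associated with the closure `Q` of the form: `f ∈ D(H)` and
`H f = h` if and only if `f ∈ D(Q)` and `Q(f, g) = ⟨h, g⟩` for all `g ∈ D(Q)`. -/
def formOperator (ι : V → E) (q : V → V → ℂ) : Set (E × E) :=
  {p | p.1 ∈ closureDomain ι q ∧ ∀ g ∈ closureDomain ι q, closureForm ι q p.1 g = inner ℂ g p.2}

/-- `R = (T - z)⁻¹` as an everywhere defined bounded operator, for the operator with graph `T`:
`R h = f` if and only if `f ∈ D(T)` and `T f - z f = h`. -/
def IsResolvent (T : Set (E × E)) (z : ℂ) (R : E →L[ℂ] E) : Prop :=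
  ∀ h f : E, R h = f ↔ (f, h + z • f) ∈ T

/-- The spectrum of the operator with graph `T`: all `z` for which `T - z` is not a bijection from
`D(T)` onto the Hilbert space with bounded inverse. -/
def opSpectrum (T : Set (E × E)) : Set ℂ :=
  {z | ¬ ∃ R : E →L[ℂ] E, IsResolvent T z R}

open Classical in
/-- The resolvent `(T - z)⁻¹` at a point `z` outside the spectrum (and `0` by convention at points
of the spectrum). -/
def resolventOp (T : Set (E × E)) (z : ℂ) : E →L[ℂ] E :=
  if h : ∃ R : E →L[ℂ] E, IsResolvent T z R then h.choose else 0

/-- The operator `exp(-t T)`, `t > 0`, for a positive self-adjoint operator `T`, by the spectral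
theorem. Since `r = 1 / (1 + lam)` corresponds to `lam = 1 / r - 1`, the function `exp(-t lam)` of
`T` is the continuous function `r ↦ exp(-t (1 / r - 1))` (with value `0` at `r = 0`, i.e. at
`lam = ∞`) of the bounded self-adjoint operator `(T + 1)⁻¹`, whose spectrum is in `[0, 1]`. -/
def expNeg [CompleteSpace E] (T : Set (E × E)) (t : ℝ) : E →L[ℂ] E :=
  cfc (fun r : ℝ => if 0 < r then Real.exp (-t * (r⁻¹ - 1)) else 0) (resolventOp T (-1))

end Forms

end MagneticSchrodinger

open MagneticSchrodinger

/-- A magnetic Schrödinger graph `(b, o, c)` over a discrete measure space `(X, m)`. -/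
structure MagneticSchrodingerGraph (X : Type*) where
  /-- the weights of the points -/
  m : X → ℝ
  m_pos : ∀ x, 0 < m x
  /-- the edge weights -/
  b : X → X → ℝ
  b_nonneg : ∀ x y, 0 ≤ b x y
  b_symm : ∀ x y, b x y = b y x
  b_diag : ∀ x, b x x = 0
  b_summable : ∀ x, Summable (b x)
  /-- the magnetic potential -/
  o : X → X → ℂ
  norm_o : ∀ x y, ‖o x y‖ = 1
  o_conj : ∀ x y, o x y = starRingEnd ℂ (o y x)
  /-- the electric potential -/
  c : X → ℝ

namespace MagneticSchrodingerGraph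

variable {X : Type*}

/-- The magnetic gradient `f(x) - o(x, y) f(y)`. -/
def grad (G : MagneticSchrodingerGraph X) (f : X → ℂ) (x y : X) : ℂ :=
  f x - G.o x y * f y

/-- The sesquilinear form `Q` on the finitely supported functions. -/
def form (G : MagneticSchrodingerGraph X) (φ ψ : X →₀ ℂ) : ℂ :=
  1 / 2 * ∑' p : X × X, (G.b p.1 p.2 : ℂ) * G.grad φ p.1 p.2 * starRingEnd ℂ (G.grad ψ p.1 p.2) +
    ∑' x : X, (G.c x : ℂ) * φ x * starRingEnd ℂ (ψ x)

/-- Positivity of `Q`; `Q(φ, φ)` is always real. -/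
def IsPositive (G : MagneticSchrodingerGraph X) : Prop :=
  ∀ φ : X →₀ ℂ, 0 ≤ (G.form φ φ).re

variable [MeasurableSpace X]

/-- The measure `m(A) = ∑_{x ∈ A} m(x)`. -/
def measure (G : MagneticSchrodingerGraph X) : Measure X :=
  Measure.sum fun x => ENNReal.ofReal (G.m x) • Measure.dirac x

/-- The Hilbert space `ℓ²(X, m)`. As every point has positive mass, its elements are functions. -/
abbrev L2 (G : MagneticSchrodingerGraph X) : Type _ := Lp ℂ 2 G.measure

variable [DiscreteMeasurableSpace X]

theorem memLp_finsupp (G : MagneticSchrodingerGraph X) (φ : X →₀ ℂ) :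
    MemLp (φ : X → ℂ) 2 G.measure := by
  classical
  induction φ using Finsupp.induction_linear with
  | zero => simp
  | add f g hf hg => simpa using hf.add hg
  | single x a =>
    have h : (Finsupp.single x a : X → ℂ) = ({x} : Set X).indicator fun _ => a := by
      ext y
      by_cases hy : y = x
      · subst hy; simp
      · simp [hy]
    rw [h]
    refine memLp_indicator_const 2 (MeasurableSet.of_discrete) a (Or.inr ?_)
    rw [measure, Measure.sum_apply _ (MeasurableSet.of_discrete), tsum_eq_single x]
    · simp
    · intro y hy
      simp [hy]

/-- The inclusion of the finitely supported functions into `ℓ²(X, m)`. -/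
def incl (G : MagneticSchrodingerGraph X) (φ : X →₀ ℂ) : G.L2 :=
  (G.memLp_finsupp φ).toLp φ

/-- `Q` is closable on `ℓ²(X, m)`. -/
def IsClosable (G : MagneticSchrodingerGraph X) : Prop :=
  FormClosable G.incl G.form

/-- (The graph of) the operator `H` associated with the closure of `Q`. -/
def H (G : MagneticSchrodingerGraph X) : Set (G.L2 × G.L2) :=
  formOperator G.incl G.form

/-- `λ₂ = inf σ(H)`. -/
def bottom (G : MagneticSchrodingerGraph X) : ℝ :=
  sInf {r : ℝ | (r : ℂ) ∈ opSpectrum G.H}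

/-- The semigroup `exp(-t H)`, `t > 0`. -/
def semigroup (G : MagneticSchrodingerGraph X) (t : ℝ) : G.L2 →L[ℂ] G.L2 :=
  expNeg G.H t

/-- The heat kernel `p_t(x, y) = ⟨exp(-t H) 1_x, 1_y⟩ / (m(x) m(y))`. -/
def heatKernel (G : MagneticSchrodingerGraph X) (t : ℝ) (x y : X) : ℂ :=
  inner ℂ (G.incl (Finsupp.single y 1)) (G.semigroup t (G.incl (Finsupp.single x 1))) /
    ((G.m x : ℂ) * (G.m y : ℂ))

end MagneticSchrodingerGraph

namespace MagneticSchrodinger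

variable {X : Type*}

/-- A pseudo metric; the value `∞` is allowed. -/
structure IsPseudoMetric (d : X → X → ℝ≥0∞) : Prop where
  self : ∀ x, d x x = 0
  symm : ∀ x y, d x y = d y x
  triangle : ∀ x y z, d x z ≤ d x y + d y z

/-- An intrinsic metric for the graph `b` over `(X, m)`: a pseudo metric `d` with
`∑_y b(x, y) d(x, y)² ≤ m(x)` for all `x`. -/
structure IsIntrinsicMetric (G : MagneticSchrodingerGraph X) (d : X → X → ℝ≥0∞) : Prop
    extends IsPseudoMetric d where
  sum_le : ∀ x, ∑' y, ENNReal.ofReal (G.b x y) * d x y ^ 2 ≤ ENNReal.ofReal (G.m x)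

/-- The jump size `s = sup {d(x, y) : b(x, y) > 0}`. -/
def jumpSize (G : MagneticSchrodingerGraph X) (d : X → X → ℝ≥0∞) : ℝ≥0∞ :=
  ⨆ (x : X) (y : X) (_ : 0 < G.b x y), d x y

/-- The distance `d(A, B) = inf {d(x, y) : x ∈ A, y ∈ B}` (`∞` if `A` or `B` is empty). -/
def setDist (d : X → X → ℝ≥0∞) (A B : Set X) : ℝ≥0∞ :=
  ⨅ (x ∈ A) (y ∈ B), d x y

/-- `ζ(r) = r arcsinh r - √(1 + r²) + 1`. -/
def zeta (r : ℝ) : ℝ := r * Real.arsinh r - √(1 + r ^ 2) + 1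

open Classical in
/-- `exp(-lam t - (t / s²) ζ(s D / t))`, which is `0` for `D = ∞`. -/
def dggBound (lam t s : ℝ) (D : ℝ≥0∞) : ℝ :=
  if D = ∞ then 0 else Real.exp (-lam * t - t / s ^ 2 * zeta (s * D.toReal / t))

end MagneticSchrodinger

end

open MagneticSchrodinger

/-! The proof is Davies' method of exponential weights. Let ρ be the distance to A = supp f,
truncated at a finite N ≤ d(A,B), and ω = exp(κρ). Then ω = 1 on A and ω = exp(κN) on B, so a bound
‖ω e^{-tH} f‖ ≤ exp(-(λ₂ - K)t) ‖ω f‖ gives |⟨e^{-tH}f, g⟩| ≤ exp(-(λ₂ - K)t - κN) ‖f‖ ‖g‖. With K =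
(cosh(κs) - 1)/s², the best rate satisfies sinh(κs) = sN/t, which produces ζ.

The weighted bound rests on Re Q(φ, ω²φ) ≥ Q(ωφ, ωφ) - K‖ωφ‖² ≥ (λ₂ - K)‖ωφ‖². The commutator is a
sum of b(x,y)(ω(x) - ω(y))² against φ(x) and φ(y). The identity `exp_sub_exp_sq`, the bound
`cosh_sub_one_le` for jumps of size at most s, and the intrinsic metric condition control it
(`abs_form_mul_sub_le`).

Unbounded operators are avoided. If W is the completion of C_c(X) in the form norm and J : W → ℓ²
the extended inclusion, injective by closability, then (H + 1)⁻¹ = JJ*. Testing the weak equation of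
the implicit Euler step (1 + τH)⁻¹ with ω²u contracts the weighted norm by (1 + τ(λ₂ - K))⁻¹
(`norm_weighted_euler_le`), and powers of Euler steps converge to e^{-tH} (`tendsto_euler`). For ω²u
to be an admissible test vector, multiplication by ω² must be bounded in the form norm;
`form_mul_le` provides this for arbitrary c. -/

namespace MagneticSchrodinger

/-! ### Closed forms as Hilbert space completions; the resolvent and the bottom of the spectrum -/

section Completion

variable {E : Type*} [NormedAddCommGroup E] [InnerProductSpace ℂ E]
variable {W : Type*} [NormedAddCommGroup W] [InnerProductSpace ℂ W]
variable {V : Type*} [AddCommGroup V] [Module ℂ V]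

/-- `W` is a Hilbert space completion of `V` in the form norm `(q φ φ + ‖ι φ‖²)^(1/2)`, where
`j : V → W` is the inclusion and `J : W → E` is the extension of `ι`, which is injective. -/
structure IsFormCompletion (q : V → V → ℂ) (j : V →ₗ[ℂ] W) (J : W →L[ℂ] E) : Prop where
  dense : DenseRange j
  inner_eq : ∀ φ ψ, inner ℂ (j ψ) (j φ) = q φ ψ + inner ℂ (J (j ψ)) (J (j φ))
  norm_le : ‖J‖ ≤ 1
  injective : Function.Injective J

section

variable {q : V → V → ℂ} {j : V →ₗ[ℂ] W} {J : W →L[ℂ] E}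

theorem form_self_eq (hinner : ∀ φ ψ, inner ℂ (j ψ) (j φ) = q φ ψ + inner ℂ (J (j ψ)) (J (j φ)))
    (φ : V) : q φ φ = ((‖j φ‖ ^ 2 - ‖J (j φ)‖ ^ 2 : ℝ) : ℂ) := by
  have := hinner φ φ
  rw [inner_self_eq_norm_sq_to_K, inner_self_eq_norm_sq_to_K] at this
  push_cast
  linear_combination -this

/-- The squared norm of W is q plus the squared norm of E, so being q-Cauchy and convergent in E is
the same as converging in W. -/
theorem formTendsto_iff [CompleteSpace W]
    (hinner : ∀ φ ψ, inner ℂ (j ψ) (j φ) = q φ ψ + inner ℂ (J (j ψ)) (J (j φ)))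
    (φ : ℕ → V) (f : E) :
    FormTendsto (fun φ => J (j φ)) q φ f ↔ ∃ w, Tendsto (fun n => j (φ n)) atTop (𝓝 w) ∧ J w = f := by
  have key : ∀ p : ℕ × ℕ, q (φ p.1 - φ p.2) (φ p.1 - φ p.2) =
      ((‖j (φ p.1) - j (φ p.2)‖ ^ 2 - ‖J (j (φ p.1)) - J (j (φ p.2))‖ ^ 2 : ℝ) : ℂ) := fun p => by
    rw [form_self_eq hinner]; simp only [map_sub]
  constructor
  · rintro ⟨h1, h2⟩
    have hc := h1.cauchySeq
    have hE : Tendsto (fun p : ℕ × ℕ => ‖J (j (φ p.1)) - J (j (φ p.2))‖ ^ 2) atTop (𝓝 0) := by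
      have := cauchySeq_iff_tendsto_dist_atTop_0.1 hc
      simpa [dist_eq_norm] using this.pow 2
    have hq : Tendsto (fun p : ℕ × ℕ => ‖j (φ p.1) - j (φ p.2)‖ ^ 2) atTop (𝓝 0) := by
      have h3 := (Complex.continuous_re.tendsto 0).comp h2
      simp only [Function.comp_def, key, Complex.ofReal_re, Complex.zero_re] at h3
      simpa using h3.add hE
    have hW : CauchySeq fun n => j (φ n) := by
      rw [cauchySeq_iff_tendsto_dist_atTop_0]
      simpa [dist_eq_norm] using hq.sqrt
    obtain ⟨w, hw⟩ := cauchySeq_tendsto_of_complete hW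
    exact ⟨w, hw, tendsto_nhds_unique ((J.continuous.tendsto w).comp hw) h1⟩
  · rintro ⟨w, hw, rfl⟩
    have h1 : Tendsto (fun n => J (j (φ n))) atTop (𝓝 (J w)) := (J.continuous.tendsto w).comp hw
    refine ⟨h1, ?_⟩
    have hE := cauchySeq_iff_tendsto_dist_atTop_0.1 h1.cauchySeq
    have hW := cauchySeq_iff_tendsto_dist_atTop_0.1 hw.cauchySeq
    simp only [dist_eq_norm] at hE hW
    simp only [key]
    have := (Complex.continuous_ofReal.tendsto 0).comp
      (by simpa using (hW.pow 2).sub (hE.pow 2) :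
        Tendsto (fun p : ℕ × ℕ => ‖j (φ p.1) - j (φ p.2)‖ ^ 2 -
          ‖J (j (φ p.1)) - J (j (φ p.2))‖ ^ 2) atTop (𝓝 0))
    simpa [Function.comp_def] using this

/-- Closability of the form amounts to injectivity of the extended inclusion. -/
theorem injective_of_formClosable [CompleteSpace W] (hj : DenseRange j)
    (hinner : ∀ φ ψ, inner ℂ (j ψ) (j φ) = q φ ψ + inner ℂ (J (j ψ)) (J (j φ)))
    (hc : FormClosable (fun φ => J (j φ)) q) : Function.Injective J := by
  rw [injective_iff_map_eq_zero]
  intro w hw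
  obtain ⟨u, hu, hlim⟩ := mem_closure_iff_seq_limit.1 (hj w)
  choose φ hφ using hu
  have hlim' : Tendsto (fun n => j (φ n)) atTop (𝓝 w) := by simpa [hφ] using hlim
  have h0 := hc φ ((formTendsto_iff hinner φ 0).2 ⟨w, hlim', hw⟩)
  have h1 := (Complex.continuous_re.tendsto 0).comp h0
  simp only [Function.comp_def, form_self_eq hinner, Complex.ofReal_re, Complex.zero_re] at h1
  have h2 := (hlim'.norm.pow 2).sub (((J.continuous.tendsto w).comp hlim').norm.pow 2)
  have h3 := tendsto_nhds_unique h1 h2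
  rw [hw] at h3
  simpa using h3.symm

end

namespace IsFormCompletion

variable {q : V → V → ℂ} {j : V →ₗ[ℂ] W} {J : W →L[ℂ] E} [CompleteSpace W]

theorem mem_closureDomain_iff (h : IsFormCompletion q j J) (f : E) :
    f ∈ closureDomain (fun φ => J (j φ)) q ↔ ∃ w, J w = f := by
  constructor
  · rintro ⟨φ, hφ⟩
    obtain ⟨w, -, hw⟩ := (formTendsto_iff h.inner_eq φ f).1 hφ
    exact ⟨w, hw⟩
  · rintro ⟨w, rfl⟩
    obtain ⟨u, hu, hlim⟩ := mem_closure_iff_seq_limit.1 (h.dense w)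
    choose φ hφ using hu
    exact ⟨φ, (formTendsto_iff h.inner_eq φ _).2 ⟨w, by simpa [hφ] using hlim, rfl⟩⟩

theorem closureForm_eq (h : IsFormCompletion q j J) (v w : W) :
    closureForm (fun φ => J (j φ)) q (J v) (J w) = inner ℂ w v - inner ℂ (J w) (J v) := by
  have hvw : J v ∈ closureDomain (fun φ => J (j φ)) q ∧ J w ∈ closureDomain (fun φ => J (j φ)) q :=
    ⟨(h.mem_closureDomain_iff _).2 ⟨v, rfl⟩, (h.mem_closureDomain_iff _).2 ⟨w, rfl⟩⟩
  rw [closureForm, dif_pos hvw]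
  apply Tendsto.limUnder_eq
  obtain ⟨v', hv', hv⟩ := (formTendsto_iff h.inner_eq _ _).1 hvw.1.choose_spec
  obtain ⟨w', hw', hw⟩ := (formTendsto_iff h.inner_eq _ _).1 hvw.2.choose_spec
  -- The approximating sequences are arbitrary choices; injectivity of `J` forces their limits in W
  -- to be `v` and `w`.
  obtain rfl := h.injective hv
  obtain rfl := h.injective hw
  have hq : ∀ φ ψ, q φ ψ = inner ℂ (j ψ) (j φ) - inner ℂ (J (j ψ)) (J (j φ)) := fun φ ψ => by
    rw [h.inner_eq]; ring
  simp only [hq]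
  exact (hw'.inner hv').sub (((J.continuous.tendsto _).comp hw').inner
    ((J.continuous.tendsto _).comp hv'))

variable [CompleteSpace E]

/-- For f = Jv, the condition Q(f, Jw) = ⟨k, Jw⟩ for all w says that v and J*(k + f) have the same
inner products in W, hence v = J*(k + f). -/
theorem mem_formOperator_iff (h : IsFormCompletion q j J) (f k : E) :
    (f, k) ∈ formOperator (fun φ => J (j φ)) q ↔ (J ∘L J.adjoint) (k + f) = f := by
  simp only [formOperator, Set.mem_ofPred_eq, ContinuousLinearMap.comp_apply]
  constructor
  · rintro ⟨hf, hg⟩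
    obtain ⟨v, rfl⟩ := (h.mem_closureDomain_iff _).1 hf
    congr 1
    refine ext_inner_left ℂ fun w => ?_
    have := hg (J w) ((h.mem_closureDomain_iff _).2 ⟨w, rfl⟩)
    rw [h.closureForm_eq] at this
    rw [ContinuousLinearMap.adjoint_inner_right, inner_add_right, ← this]
    ring
  · intro hf
    refine ⟨(h.mem_closureDomain_iff _).2 ⟨_, hf⟩, fun g hg => ?_⟩
    obtain ⟨w, rfl⟩ := (h.mem_closureDomain_iff _).1 hg
    nth_rw 1 [← hf]
    rw [h.closureForm_eq, hf, ContinuousLinearMap.adjoint_inner_right, inner_add_right]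
    ring

theorem isResolvent_neg_one (h : IsFormCompletion q j J) :
    IsResolvent (formOperator (fun φ => J (j φ)) q) (-1) (J ∘L J.adjoint) := by
  intro k f
  rw [h.mem_formOperator_iff]
  simp

theorem resolventOp_neg_one (h : IsFormCompletion q j J) :
    resolventOp (formOperator (fun φ => J (j φ)) q) (-1) = J ∘L J.adjoint := by
  have hex : ∃ R : E →L[ℂ] E, IsResolvent (formOperator (fun φ => J (j φ)) q) (-1) R :=
    ⟨_, h.isResolvent_neg_one⟩
  rw [resolventOp, dif_pos hex]
  ext k
  rw [hex.choose_spec k, ← h.isResolvent_neg_one k]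

theorem isResolvent_iff (h : IsFormCompletion q j J) (z : ℂ) (S : E →L[ℂ] E) :
    IsResolvent (formOperator (fun φ => J (j φ)) q) z S ↔
      ∀ k f, S k = f ↔ (1 - (z + 1) • (J ∘L J.adjoint)) f = (J ∘L J.adjoint) k := by
  refine forall₂_congr fun k f => ?_
  rw [h.mem_formOperator_iff]
  simp only [map_add, map_smul, sub_apply, one_apply_eq_self,
    smul_apply, add_apply, add_smul, one_smul]
  refine iff_congr Iff.rfl ⟨fun h => ?_, fun h => ?_⟩
  · nth_rw 1 [← h]; abel
  · rw [add_assoc, ← h]; abel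

theorem comp_adjoint_nonneg (J : W →L[ℂ] E) : 0 ≤ J ∘L J.adjoint :=
  (ContinuousLinearMap.nonneg_iff_isPositive _).2
    (ContinuousLinearMap.isPositive_self_comp_adjoint J)

theorem norm_comp_adjoint (J : W →L[ℂ] E) : ‖J ∘L J.adjoint‖ = ‖J‖ ^ 2 := by
  have := ContinuousLinearMap.norm_adjoint_comp_self J.adjoint
  rw [ContinuousLinearMap.adjoint_adjoint, LinearIsometryEquiv.norm_map] at this
  rw [this, sq]

theorem spectrum_subset (h : IsFormCompletion q j J) :
    spectrum ℝ (J ∘L J.adjoint) ⊆ Set.Icc 0 1 := by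
  intro r hr
  have h0 : 0 ≤ r := spectrum_nonneg_of_nonneg (comp_adjoint_nonneg J) hr
  refine ⟨h0, ?_⟩
  have h1 := spectrum.norm_le_norm_mul_of_mem hr
  rw [norm_comp_adjoint, Real.norm_of_nonneg h0] at h1
  have h2 : ‖J‖ ^ 2 ≤ 1 := pow_le_one₀ (norm_nonneg _) h.norm_le
  have h3 : ‖(1 : E →L[ℂ] E)‖ ≤ 1 := ContinuousLinearMap.norm_id_le
  calc r ≤ _ := h1
    _ ≤ 1 * 1 := by gcongr
    _ = 1 := one_mul 1

/-- Every real point of the spectrum is at least `-1`. -/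
theorem neg_one_le_of_mem_opSpectrum (h : IsFormCompletion q j J) {r : ℝ}
    (hr : (r : ℂ) ∈ opSpectrum (formOperator (fun φ => J (j φ)) q)) : -1 ≤ r := by
  by_contra! hlt
  apply hr
  set R := J ∘L J.adjoint
  have ha : 0 < -(r + 1) := by linarith
  have hunit : IsUnit (1 - ((r : ℂ) + 1) • R) := by
    -- For r < -1 the number 1/(r + 1) is negative, hence outside the spectrum of the positive
    -- operator R.
    have hnot : ((r + 1)⁻¹ : ℝ) ∉ spectrum ℝ R := fun hmem => by
      have := (h.spectrum_subset hmem).1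
      have : (r + 1)⁻¹ < 0 := inv_lt_zero.2 (by linarith)
      linarith
    rw [spectrum.notMem_iff] at hnot
    have hne : (r : ℂ) + 1 ≠ 0 := by exact_mod_cast (by linarith : r + 1 ≠ 0)
    have : (1 - ((r : ℂ) + 1) • R) = (Units.mk0 _ hne) • (algebraMap ℝ (E →L[ℂ] E) (r + 1)⁻¹ - R) := by
      ext x
      have h2 : ∀ y : E, ((r + 1)⁻¹ : ℝ) • y = ((r : ℂ) + 1)⁻¹ • y := fun y => by
        rw [← Complex.coe_smul]; push_cast; rfl
      simp [Units.smul_def, Algebra.algebraMap_eq_smul_one, smul_sub, h2, smul_smul, hne]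
    rw [this]
    exact hnot.smul _
  obtain ⟨U, hU⟩ := hunit
  refine ⟨(↑U⁻¹ : E →L[ℂ] E) * R, (h.isResolvent_iff _ _).2 fun k f => ?_⟩
  rw [← hU]
  constructor
  · rintro rfl
    rw [← mul_apply_eq_comp, ← mul_assoc, Units.mul_inv, one_mul]
  · intro hf
    rw [mul_apply_eq_comp, ← hf, ← mul_apply_eq_comp, Units.inv_mul,
      one_apply_eq_self]

/-- The point `1 / ‖R‖ - 1` is in the spectrum, where `R` is the resolvent at `-1`. -/
theorem mem_opSpectrum (h : IsFormCompletion q j J) (hJ : J ≠ 0) :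
    (((‖J‖ ^ 2)⁻¹ - 1 : ℝ) : ℂ) ∈ opSpectrum (formOperator (fun φ => J (j φ)) q) := by
  rintro ⟨S, hS⟩
  rw [h.isResolvent_iff] at hS
  set R := J ∘L J.adjoint with hR
  have hn : ‖J‖ ≠ 0 := by simpa using hJ
  have hne : ((‖J‖ ^ 2 : ℝ) : ℂ) ≠ 0 := by exact_mod_cast pow_ne_zero 2 hn
  have hnt : Nontrivial (E →L[ℂ] E) := ⟨R, 0, fun h0 => by
    have := norm_comp_adjoint J
    rw [← hR, h0, norm_zero] at this
    exact pow_ne_zero 2 hn this.symm⟩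
  have hmem : ‖J‖ ^ 2 ∈ spectrum ℝ R := by
    rw [← norm_comp_adjoint J]
    exact CStarAlgebra.norm_mem_spectrum_of_nonneg (comp_adjoint_nonneg J)
  rw [spectrum.mem_iff] at hmem
  apply hmem
  set T : E →L[ℂ] E := algebraMap ℝ (E →L[ℂ] E) (‖J‖ ^ 2) - R with hT
  have hTS : ∀ f, (1 - ((((‖J‖ ^ 2)⁻¹ - 1 : ℝ) : ℂ) + 1) • R) f = ((‖J‖ ^ 2 : ℝ) : ℂ)⁻¹ • T f := by
    intro f
    have h2 : ∀ y : E, ((‖J‖ ^ 2 : ℝ)) • y = ((‖J‖ ^ 2 : ℝ) : ℂ) • y := fun y => by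
      rw [← Complex.coe_smul]
    simp only [hT, sub_apply, Algebra.algebraMap_eq_smul_one, smul_apply,
      one_apply_eq_self, h2, smul_sub, smul_smul, inv_mul_cancel₀ hne, one_smul]
    push_cast
    simp
  -- With c = ‖J‖², the resolvent equation reads TS = cR, so T(c⁻²S + c⁻¹) = c⁻¹R + c⁻¹(c - R) = 1.
  -- The adjoint of this right inverse is a left inverse, as T is self-adjoint.
  have hright : T * (((‖J‖ ^ 2 : ℝ) : ℂ)⁻¹ • (((‖J‖ ^ 2 : ℝ) : ℂ)⁻¹ • S + 1)) = 1 := by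
    ext f
    have h1 := (hS f (S f)).1 rfl
    rw [hTS] at h1
    simp only [mul_apply_eq_comp, smul_apply, add_apply, one_apply_eq_self,
      map_smul, map_add, smul_add, h1]
    have h3 : T f = ((‖J‖ ^ 2 : ℝ) : ℂ) • f - R f := by
      simp [hT, Algebra.algebraMap_eq_smul_one, ← Complex.coe_smul]
    rw [h3, smul_sub, smul_smul, inv_mul_cancel₀ hne, one_smul]
    abel
  have hsa : IsSelfAdjoint T := by
    have : IsSelfAdjoint R := (comp_adjoint_nonneg J).isSelfAdjoint
    exact ((IsSelfAdjoint.all (‖J‖ ^ 2)).algebraMap _).sub this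
  have hleft := congrArg star hright
  rw [star_mul, hsa.star_eq, star_one] at hleft
  exact isUnit_iff_exists_and_exists.2 ⟨⟨_, hright⟩, ⟨_, hleft⟩⟩

/-- The lower bound of the spectrum is a lower bound of the form. -/
theorem bottom_le_form (h : IsFormCompletion q j J) (hJ : J ≠ 0) (w : W) :
    sInf {r : ℝ | (r : ℂ) ∈ opSpectrum (formOperator (fun φ => J (j φ)) q)} * ‖J w‖ ^ 2 ≤
      ‖w‖ ^ 2 - ‖J w‖ ^ 2 := by
  have hle : sInf {r : ℝ | (r : ℂ) ∈ opSpectrum (formOperator (fun φ => J (j φ)) q)} ≤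
      (‖J‖ ^ 2)⁻¹ - 1 :=
    -- The crude bound -1 serves only to make the set bounded below, as the real `sInf` requires.
    csInf_le ⟨-1, fun r hr => h.neg_one_le_of_mem_opSpectrum hr⟩ (h.mem_opSpectrum hJ)
  have hn : 0 < ‖J‖ := norm_pos_iff.2 hJ
  have h1 : ‖J w‖ ^ 2 ≤ ‖J‖ ^ 2 * ‖w‖ ^ 2 := by
    rw [← mul_pow]; gcongr; exact J.le_opNorm w
  have h2 : (‖J‖ ^ 2)⁻¹ * ‖J w‖ ^ 2 ≤ ‖w‖ ^ 2 := by
    rw [inv_mul_le_iff₀ (by positivity)]; exact h1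
  nlinarith [mul_le_mul_of_nonneg_right hle (sq_nonneg ‖J w‖)]

end IsFormCompletion

end Completion

end MagneticSchrodinger

/-! ### The implicit Euler approximation of the semigroup -/

namespace MagneticSchrodinger

/-- `(1 + τ lam)⁻¹` as a function of `r = (1 + lam)⁻¹`. -/
noncomputable def eulerStep (τ r : ℝ) : ℝ := r / (r + τ * (1 - r))

theorem eulerStep_denom_pos {τ r : ℝ} (hτ : 0 < τ) (hr : r ∈ Set.Icc (0 : ℝ) 1) :
    0 < r + τ * (1 - r) := by
  rcases hr.1.eq_or_lt with h | h
  · rw [← h]; simpa using hτ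
  · have := mul_nonneg hτ.le (sub_nonneg.2 hr.2)
    linarith

theorem continuousOn_eulerStep {τ : ℝ} (hτ : 0 < τ) :
    ContinuousOn (eulerStep τ) (Set.Icc 0 1) := by
  unfold eulerStep
  exact ContinuousOn.div (by fun_prop) (by fun_prop) fun r hr => (eulerStep_denom_pos hτ hr).ne'

theorem eulerStep_eq {τ r : ℝ} (hr : 0 < r) :
    eulerStep τ r = (1 + τ * (r⁻¹ - 1))⁻¹ := by
  rw [eulerStep, ← mul_div_mul_left r _ (inv_ne_zero hr.ne'), inv_mul_cancel₀ hr.ne', mul_add,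
    inv_mul_cancel₀ hr.ne', one_div]
  congr 2
  field_simp

/-- The error of the implicit Euler method with `2 k` steps. -/
theorem abs_inv_one_add_pow_sub_exp_le {y : ℝ} (hy : 0 ≤ y) {k : ℕ} (hk : k ≠ 0) :
    |((1 + y / (2 * k : ℕ))⁻¹) ^ (2 * k) - Real.exp (-y)| ≤ 2 / k := by
  have hk0 : (0 : ℝ) < k := by exact_mod_cast Nat.pos_of_ne_zero hk
  set z : ℝ := y / (2 * k : ℕ) with hz
  have hz0 : 0 ≤ z := by positivity
  have hyz : y = (2 * k : ℕ) * z := by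
    rw [hz]; push_cast; field_simp
  set a : ℝ := (1 + z)⁻¹ with ha
  set b : ℝ := Real.exp (-z) with hb
  have hexp : Real.exp (-y) = b ^ (2 * k) := by
    rw [hb, ← Real.exp_nat_mul, hyz]; ring_nf
  have ha0 : 0 < a := by positivity
  have hb0 : 0 < b := Real.exp_pos _
  have hba : b ≤ a := by
    rw [hb, ha, Real.exp_neg]
    exact inv_anti₀ (by positivity) (by linarith [Real.add_one_le_exp z])
  -- Since a(1 + z) = 1, one has a - (1 - z) = z²a, and b ≥ 1 - z.
  have hab : a - b ≤ z ^ 2 * a := by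
    have h1 : 1 - z ≤ b := by linarith [Real.add_one_le_exp (-z)]
    have h2 : a * (1 + z) = 1 := inv_mul_cancel₀ (by positivity)
    nlinarith
  have hpow : b ^ (2 * k) ≤ a ^ (2 * k) := by gcongr
  rw [hexp, abs_of_nonneg (by linarith)]
  have hfac : a ^ (2 * k) - b ^ (2 * k) ≤ (2 * k : ℕ) * (z ^ 2 * a ^ (2 * k)) := by
    rw [← Commute.geom_sum₂_mul (Commute.all a b)]
    have hsum : ∑ i ∈ Finset.range (2 * k), a ^ i * b ^ (2 * k - 1 - i) ≤
        (2 * k : ℕ) * a ^ (2 * k - 1) := by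
      calc _ ≤ ∑ i ∈ Finset.range (2 * k), a ^ (2 * k - 1) := by
            refine Finset.sum_le_sum fun i hi => ?_
            have hi' : i + (2 * k - 1 - i) = 2 * k - 1 := by
              have := Finset.mem_range.1 hi; omega
            rw [← hi', pow_add, hi']
            gcongr
        _ = _ := by simp
    calc _ ≤ ((2 * k : ℕ) * a ^ (2 * k - 1)) * (z ^ 2 * a) := by
          gcongr
      _ = (2 * k : ℕ) * (z ^ 2 * (a ^ (2 * k - 1) * a)) := by ring
      _ = _ := by rw [← pow_succ]; congr 4; omega
  refine hfac.trans ?_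
  -- The even number of steps is used here: (1 + z)^(2k) is the square of (1 + z)^k ≥ kz, which
  -- absorbs z² and makes the error 2k·z²·a^(2k) at most 2/k, uniformly in y.
  have hbern : 1 + k * z ≤ (1 + z) ^ k := one_add_mul_le_pow (by linarith) k
  have hge : (k * z) ^ 2 ≤ (1 + z) ^ (2 * k) := by
    rw [mul_comm 2 k, pow_mul]
    have : 0 ≤ k * z := by positivity
    gcongr
    linarith
  have hle : (k * z) ^ 2 * a ^ (2 * k) ≤ 1 := by
    rw [ha, inv_pow, ← div_eq_mul_inv]
    exact div_le_one_of_le₀ hge (by positivity)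
  rw [le_div_iff₀ hk0]
  push_cast
  nlinarith

theorem abs_eulerStep_pow_sub_le {t r : ℝ} (ht : 0 < t) (hr : r ∈ Set.Icc (0 : ℝ) 1) {k : ℕ}
    (hk : k ≠ 0) :
    |eulerStep (t / (2 * k : ℕ)) r ^ (2 * k) -
      (if 0 < r then Real.exp (-t * (r⁻¹ - 1)) else 0)| ≤ 2 / k := by
  split_ifs with h
  · have hy : 0 ≤ t * (r⁻¹ - 1) := mul_nonneg ht.le (sub_nonneg.2 ((one_le_inv₀ h).2 hr.2))
    have := abs_inv_one_add_pow_sub_exp_le hy hk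
    rw [eulerStep_eq h]
    convert this using 4 <;> ring
  · obtain rfl : r = 0 := le_antisymm (not_lt.1 h) hr.1
    have : eulerStep (t / (2 * k : ℕ)) 0 = 0 := by simp [eulerStep]
    rw [this, zero_pow (by omega)]
    simp only [sub_zero, abs_zero]
    positivity

/-! ### Weighted norm estimates of Euler steps and of the semigroup -/

section Semigroup

variable {E : Type*} [NormedAddCommGroup E] [InnerProductSpace ℂ E] [CompleteSpace E]
variable {W : Type*} [NormedAddCommGroup W] [InnerProductSpace ℂ W] [CompleteSpace W]
variable {V : Type*} [AddCommGroup V] [Module ℂ V]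
variable {q : V → V → ℂ} {j : V →ₗ[ℂ] W} {J : W →L[ℂ] E}

namespace IsFormCompletion

/-- The Euler error 2/k is uniform on [0, 1], which contains the spectrum of JJ*, so the functional
calculus gives convergence in operator norm. -/
theorem tendsto_euler (h : IsFormCompletion q j J) {t : ℝ} (ht : 0 < t) :
    Tendsto (fun k : ℕ => cfc (eulerStep (t / (2 * k : ℕ))) (J ∘L J.adjoint) ^ (2 * k)) atTop
      (𝓝 (expNeg (formOperator (fun φ => J (j φ)) q) t)) := by
  have hsa : IsSelfAdjoint (J ∘L J.adjoint) := (comp_adjoint_nonneg J).isSelfAdjoint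
  have hcont : ∀ k : ℕ, k ≠ 0 →
      ContinuousOn (eulerStep (t / (2 * k : ℕ))) (spectrum ℝ (J ∘L J.adjoint)) := fun k hk =>
    (continuousOn_eulerStep (by positivity)).mono h.spectrum_subset
  rw [expNeg, h.resolventOp_neg_one]
  have hlim : Tendsto (fun k : ℕ => cfc (fun r => eulerStep (t / (2 * k : ℕ)) r ^ (2 * k))
      (J ∘L J.adjoint)) atTop
      (𝓝 (cfc (fun r : ℝ => if 0 < r then Real.exp (-t * (r⁻¹ - 1)) else 0) (J ∘L J.adjoint))) := by
    refine tendsto_cfc_fun ?_ ?_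
    · rw [Metric.tendstoUniformlyOn_iff]
      intro ε hε
      have hk : Tendsto (fun k : ℕ => (2 : ℝ) / k) atTop (𝓝 0) :=
        tendsto_const_div_atTop_nhds_zero_nat 2
      filter_upwards [hk.eventually_lt_const hε, eventually_ne_atTop 0] with k hk hk0 r hr
      rw [dist_comm, Real.dist_eq]
      exact (abs_eulerStep_pow_sub_le ht (h.spectrum_subset hr) hk0).trans_lt hk
    · filter_upwards [eventually_ne_atTop 0] with k hk
      exact (hcont k hk).pow _
  refine hlim.congr' ?_
  filter_upwards [eventually_ne_atTop 0] with k hk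
  exact cfc_pow _ _ _ (hcont k hk) hsa

/-- The vector `u = (1 + τ H)⁻¹ f` solves the equation `u + τ H u = f` weakly. -/
theorem euler_weak (h : IsFormCompletion q j J) {τ : ℝ} (hτ : 0 < τ) (f : E) :
    ∃ v : W, J v = cfc (eulerStep τ) (J ∘L J.adjoint) f ∧
      ∀ w, τ * (inner ℂ w v - inner ℂ (J w) (J v)) = inner ℂ (J w) (f - J v) := by
  have hsa : IsSelfAdjoint (J ∘L J.adjoint) := (comp_adjoint_nonneg J).isSelfAdjoint
  have hc : ContinuousOn (eulerStep τ) (spectrum ℝ (J ∘L J.adjoint)) :=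
    (continuousOn_eulerStep hτ).mono h.spectrum_subset
  set R := J ∘L J.adjoint with hR
  set A := cfc (eulerStep τ) R with hA
  -- This identity places A f in the range of JJ* and thereby supplies the lift v of A f to W.
  have hop : τ • A = R * (1 - A + τ • A) := by
    calc τ • A = cfc (fun r => τ * eulerStep τ r) R := (cfc_const_mul τ _ R hc).symm
      _ = cfc (fun r => r * (1 - eulerStep τ r + τ * eulerStep τ r)) R := by
          refine cfc_congr fun r hr => ?_
          have := eulerStep_denom_pos hτ (h.spectrum_subset hr)
          simp only [eulerStep]
          field_simp
          ring
      _ = R * (1 - A + τ • A) := by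
          have hd : ContinuousOn (fun r => τ * eulerStep τ r) (spectrum ℝ R) := hc.const_mul _
          have he : ContinuousOn (fun r => 1 - eulerStep τ r) (spectrum ℝ R) :=
            continuousOn_const.sub hc
          have hs : ContinuousOn (fun r => 1 - eulerStep τ r + τ * eulerStep τ r) (spectrum ℝ R) :=
            he.add hd
          rw [cfc_mul (fun r => r) _ R continuousOn_id hs, cfc_id' ℝ R,
            cfc_add R (fun r => 1 - eulerStep τ r) _ he hd, cfc_const_mul τ _ R hc,
            cfc_sub (fun _ => 1) _ R continuousOn_const hc, cfc_const_one ℝ R]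
  have hτ' : (τ : ℂ) ≠ 0 := by exact_mod_cast hτ.ne'
  have happ : (τ : ℂ) • A f = R (f - A f + (τ : ℂ) • A f) := by
    have := DFunLike.congr_fun hop f
    simpa [← Complex.coe_smul] using this
  refine ⟨(τ : ℂ)⁻¹ • J.adjoint (f - A f + (τ : ℂ) • A f), ?_, fun w => ?_⟩
  · rw [map_smul, ← ContinuousLinearMap.comp_apply, ← hR, ← happ, smul_smul, inv_mul_cancel₀ hτ',
      one_smul]
  · have hJ : J ((τ : ℂ)⁻¹ • J.adjoint (f - A f + (τ : ℂ) • A f)) = A f := by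
      rw [map_smul, ← ContinuousLinearMap.comp_apply, ← hR, ← happ, smul_smul, inv_mul_cancel₀ hτ',
        one_smul]
    rw [hJ, inner_smul_right, ContinuousLinearMap.adjoint_inner_right, inner_add_right,
      inner_smul_right]
    field_simp
    ring

section Weighted

variable {M : E →L[ℂ] E} {M₂ : W →L[ℂ] W} {a : ℝ}

/-- The weak equation is tested with `M₂ v`, where `M₂` lifts M² to W. As M is symmetric, the right
side becomes Re⟨MJv, Mf⟩ - ‖MJv‖², and Cauchy–Schwarz concludes. The hypothesis `ha` is the lower
bound Re Q(u, M²u) ≥ a‖Mu‖² for u = Jv. -/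
theorem norm_weighted_euler_le (h : IsFormCompletion q j J)
    (hM : ∀ x y, inner ℂ (M x) y = inner ℂ x (M y)) (hJM : ∀ v, J (M₂ v) = M (M (J v)))
    (ha : ∀ v, a * ‖M (J v)‖ ^ 2 ≤ (inner ℂ (M₂ v) v).re - ‖M (J v)‖ ^ 2)
    {τ : ℝ} (hτ : 0 < τ) (haτ : 0 < 1 + τ * a) (f : E) :
    ‖M (cfc (eulerStep τ) (J ∘L J.adjoint) f)‖ ≤ (1 + τ * a)⁻¹ * ‖M f‖ := by
  obtain ⟨v, hv, hw⟩ := h.euler_weak hτ f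
  rw [← hv]
  have h1 := congrArg Complex.re (hw (M₂ v))
  rw [hJM, hM (M (J v)) (J v), hM (M (J v)) (f - J v), map_sub, inner_sub_right, inner_self_eq_norm_sq_to_K] at h1
  have h2 : (inner ℂ (M (J v)) (M f)).re ≤ ‖M (J v)‖ * ‖M f‖ :=
    (Complex.re_le_norm _).trans (norm_inner_le_norm _ _)
  have h3 : τ * ((inner ℂ (M₂ v) v).re - ‖M (J v)‖ ^ 2) =
      (inner ℂ (M (J v)) (M f)).re - ‖M (J v)‖ ^ 2 := by
    rw [Complex.re_ofReal_mul] at h1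
    simpa [← Complex.ofReal_pow] using h1
  rw [le_inv_mul_iff₀ haτ]
  have h4 : (1 + τ * a) * ‖M (J v)‖ ^ 2 ≤ ‖M (J v)‖ * ‖M f‖ := by
    nlinarith [mul_le_mul_of_nonneg_left (ha v) hτ.le]
  rcases (norm_nonneg (M (J v))).eq_or_lt with h0 | h0
  · rw [← h0]; simp
  · refine le_of_mul_le_mul_left ?_ h0
    linarith

/-- A weighted norm estimate of the semigroup from a weighted lower bound of the form. -/
theorem norm_weighted_expNeg_le (h : IsFormCompletion q j J)
    (hM : ∀ x y, inner ℂ (M x) y = inner ℂ x (M y)) (hJM : ∀ v, J (M₂ v) = M (M (J v)))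
    (ha : ∀ v, a * ‖M (J v)‖ ^ 2 ≤ (inner ℂ (M₂ v) v).re - ‖M (J v)‖ ^ 2)
    {t : ℝ} (ht : 0 < t) (f : E) :
    ‖M (expNeg (formOperator (fun φ => J (j φ)) q) t f)‖ ≤ Real.exp (-a * t) * ‖M f‖ := by
  have htwo : Tendsto (fun k : ℕ => 2 * k) atTop atTop :=
    tendsto_id.const_mul_atTop' (by norm_num)
  have hl : Tendsto (fun k : ℕ => ‖M ((cfc (eulerStep (t / (2 * k : ℕ))) (J ∘L J.adjoint) ^ (2 * k)) f)‖)
      atTop (𝓝 ‖M (expNeg (formOperator (fun φ => J (j φ)) q) t f)‖) := by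
    have := ((ContinuousLinearMap.apply ℂ E f).continuous.tendsto _).comp (h.tendsto_euler ht)
    exact ((M.continuous.tendsto _).comp this).norm
  have hr : Tendsto (fun k : ℕ => ((1 + t / (2 * k : ℕ) * a)⁻¹) ^ (2 * k) * ‖M f‖) atTop
      (𝓝 (Real.exp (-a * t) * ‖M f‖)) := by
    have h1 := ((Real.tendsto_one_add_div_pow_exp (t * a)).comp htwo).inv₀ (Real.exp_ne_zero _)
    rw [← Real.exp_neg] at h1
    refine (Tendsto.mul_const _ ?_)
    convert h1 using 1
    · ext k
      simp only [Function.comp_apply, inv_pow]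
      ring_nf
    · ring_nf
  refine le_of_tendsto_of_tendsto hl hr ?_
  -- The constant a may be negative, so positivity holds only for small steps.
  have hpos : ∀ᶠ k : ℕ in atTop, 0 < 1 + t / (2 * k : ℕ) * a := by
    have h1 : Tendsto (fun k : ℕ => 1 + t / (2 * k : ℕ) * a) atTop (𝓝 (1 + 0 * a)) :=
      (((tendsto_const_div_atTop_nhds_zero_nat t).comp htwo).mul_const a).const_add 1
    exact h1.eventually_const_lt (by norm_num)
  filter_upwards [hpos, eventually_ne_atTop 0] with k hk hk0
  have hiter : ∀ n : ℕ, ‖M ((cfc (eulerStep (t / (2 * k : ℕ))) (J ∘L J.adjoint) ^ n) f)‖ ≤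
      ((1 + t / (2 * k : ℕ) * a)⁻¹) ^ n * ‖M f‖ := by
    intro n
    induction n with
    | zero => simp
    | succ n ih =>
      rw [pow_succ', mul_apply_eq_comp, pow_succ', mul_assoc]
      refine (h.norm_weighted_euler_le hM hJM ha (by positivity) hk _).trans ?_
      gcongr
  exact hiter _

end Weighted

end IsFormCompletion

end Semigroup

end MagneticSchrodinger

/-! ### Construction of the form completion -/

namespace MagneticSchrodinger

universe v in
/-- A positive Hermitian closable form has a form completion. -/
theorem exists_isFormCompletion {E : Type*} [NormedAddCommGroup E] [InnerProductSpace ℂ E]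
    [CompleteSpace E] {V : Type v} [AddCommGroup V] [Module ℂ V] (ι : V →ₗ[ℂ] E)
    (hι : Function.Injective ι) (q : V → V → ℂ)
    (hadd : ∀ φ₁ φ₂ ψ, q (φ₁ + φ₂) ψ = q φ₁ ψ + q φ₂ ψ)
    (hsmul : ∀ (z : ℂ) φ ψ, q (z • φ) ψ = z * q φ ψ)
    (hconj : ∀ φ ψ, starRingEnd ℂ (q φ ψ) = q ψ φ)
    (hpos : ∀ φ, 0 ≤ (q φ φ).re) (hclos : FormClosable ι q) :
    ∃ (W : Type v) (_ : NormedAddCommGroup W) (_ : InnerProductSpace ℂ W) (_ : CompleteSpace W)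
      (j : V →ₗ[ℂ] W) (J : W →L[ℂ] E), IsFormCompletion q j J ∧ (fun φ => J (j φ)) = ι := by
  let core : InnerProductSpace.Core ℂ V :=
    { inner := fun φ ψ => q ψ φ + inner ℂ (ι φ) (ι ψ)
      conj_inner_symm := fun φ ψ => by rw [map_add, hconj, inner_conj_symm]
      re_inner_nonneg := fun φ => by
        rw [map_add]
        exact add_nonneg (hpos φ) (inner_self_nonneg (𝕜 := ℂ) (x := ι φ))
      add_left := fun φ₁ φ₂ ψ => by
        have : q ψ (φ₁ + φ₂) = q ψ φ₁ + q ψ φ₂ := by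
          rw [← hconj, hadd, map_add, hconj, hconj]
        rw [this, map_add, inner_add_left]
        ring
      smul_left := fun φ ψ z => by
        have : q ψ (z • φ) = starRingEnd ℂ z * q ψ φ := by
          rw [← hconj, hsmul, map_mul, hconj]
        rw [this, map_smul, inner_smul_left]
        ring
      -- The form q may be degenerate; definiteness comes from ‖ι φ‖² and the injectivity of ι.
      definite := fun φ h => by
        have h1 := congrArg Complex.re h
        have h2 := hpos φ
        have h3 : (inner ℂ (ι φ) (ι φ)).re = ‖ι φ‖ ^ 2 := by
          rw [inner_self_eq_norm_sq_to_K]; simp [← Complex.ofReal_pow]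
        rw [Complex.add_re, h3, Complex.zero_re] at h1
        have h4 : ‖ι φ‖ = 0 := by nlinarith [norm_nonneg (ι φ)]
        exact hι (by rw [norm_eq_zero.1 h4, map_zero]) }
  let _ : NormedAddCommGroup V := core.toNormedAddCommGroup
  let _ : InnerProductSpace ℂ V := InnerProductSpace.ofCore core.toCore
  have hin : ∀ φ ψ : V, inner ℂ ψ φ = q φ ψ + inner ℂ (ι ψ) (ι φ) := fun _ _ => rfl
  let j : V →ₗ[ℂ] UniformSpace.Completion V :=
    (UniformSpace.Completion.toComplL (𝕜 := ℂ) (E := V) : V →L[ℂ] UniformSpace.Completion V)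
  have hj : ∀ φ, j φ = (φ : UniformSpace.Completion V) := fun _ => rfl
  have hdense : DenseRange j := UniformSpace.Completion.denseRange_coe
  have hle : ∀ φ, ‖ι φ‖ ≤ 1 * ‖j φ‖ := fun φ => by
    rw [one_mul, hj, UniformSpace.Completion.norm_coe]
    refine le_of_sq_le_sq ?_ (norm_nonneg _)
    have h1 := congrArg Complex.re (hin φ φ)
    rw [inner_self_eq_norm_sq_to_K, inner_self_eq_norm_sq_to_K] at h1
    have h2 := hpos φ
    simp [← Complex.ofReal_pow] at h1
    linarith
  have hJ : ∀ φ, ι.extendOfNorm j (j φ) = ι φ :=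
    fun φ => LinearMap.extendOfNorm_eq hdense ⟨1, hle⟩ φ
  have hinner : ∀ φ ψ, inner ℂ (j ψ) (j φ) =
      q φ ψ + inner ℂ (ι.extendOfNorm j (j ψ)) (ι.extendOfNorm j (j φ)) := fun φ ψ => by
    rw [hJ, hJ, hj, hj, UniformSpace.Completion.inner_coe, hin]
  have hfun : (fun φ => ι.extendOfNorm j (j φ)) = ι := funext hJ
  refine ⟨UniformSpace.Completion V, inferInstance, inferInstance, inferInstance, j,
    ι.extendOfNorm j, ⟨hdense, hinner, ?_, injective_of_formClosable hdense hinner ?_⟩, hfun⟩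
  · exact LinearMap.opNorm_extendOfNorm_le hdense zero_le_one hle
  · rwa [hfun]

end MagneticSchrodinger

/-! ### Multiplication operators and the commutator with the form -/

namespace MagneticSchrodingerGraph

variable {X : Type*}

/-- Multiplication of a finitely supported function by a real function. -/
noncomputable def mulFinsupp (η : X → ℝ) : (X →₀ ℂ) →ₗ[ℂ] (X →₀ ℂ) where
  toFun φ := Finsupp.onFinset φ.support (fun x => (η x : ℂ) * φ x) fun x hx => by
    simpa using right_ne_zero_of_mul hx
  map_add' φ ψ := by ext x; simp [mul_add]
  map_smul' z φ := by ext x; simp [mul_left_comm]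

@[simp]
theorem mulFinsupp_apply (η : X → ℝ) (φ : X →₀ ℂ) (x : X) : mulFinsupp η φ x = η x * φ x := rfl

/-! ### The form on finitely supported functions -/

theorem summable_mul_of_hasFiniteSupport {a : X → ℝ} (haf : a.HasFiniteSupport) (c : X → ℝ) :
    Summable fun x => c x * a x := by
  refine summable_of_hasFiniteSupport (Set.Finite.subset haf fun x hx => ?_)
  exact right_ne_zero_of_mul hx

theorem hasSum_prod_mul {k : X → X → ℝ} (hk0 : ∀ x y, 0 ≤ k x y) (hks : ∀ x, Summable (k x))
    {a : X → ℝ} (ha : ∀ x, 0 ≤ a x) (haf : a.HasFiniteSupport) :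
    HasSum (fun p : X × X => k p.1 p.2 * a p.1) (∑' x, (∑' y, k x y) * a x) := by
  have hs : Summable fun p : X × X => k p.1 p.2 * a p.1 := by
    have h0 : 0 ≤ fun p : X × X => k p.1 p.2 * a p.1 := fun p => mul_nonneg (hk0 _ _) (ha _)
    rw [summable_prod_of_nonneg h0]
    refine ⟨fun x => ?_, ?_⟩
    · change Summable fun y => k x y * a x
      exact (hks x).mul_right _
    · change Summable fun x => ∑' y, k x y * a x
      simp only [tsum_mul_right]
      exact summable_mul_of_hasFiniteSupport haf _
  have := hs.tsum_prod
  simp only [tsum_mul_right] at this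
  rw [← this]
  exact hs.hasSum

theorem hasSum_prod_mul' {k : X → X → ℝ} (hk0 : ∀ x y, 0 ≤ k x y) (hks : ∀ x, Summable (k x))
    (hsymm : ∀ x y, k x y = k y x) {a : X → ℝ} (ha : ∀ x, 0 ≤ a x) (haf : a.HasFiniteSupport) :
    HasSum (fun p : X × X => k p.1 p.2 * a p.2) (∑' x, (∑' y, k x y) * a x) := by
  rw [← (Equiv.prodComm X X).hasSum_iff]
  convert hasSum_prod_mul hk0 hks ha haf using 2 with p
  simp [hsymm p.2 p.1]

theorem hasFiniteSupport_of_finsupp {φ : X →₀ ℂ} {R : Type*} [Zero R] {a : X → R}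
    (h : ∀ x, φ x = 0 → a x = 0) : a.HasFiniteSupport :=
  Set.Finite.subset φ.hasFiniteSupport fun x hx h0 => hx (h x h0)

variable (G : MagneticSchrodingerGraph X)

theorem norm_grad_le (φ : X → ℂ) (x y : X) : ‖G.grad φ x y‖ ≤ ‖φ x‖ + ‖φ y‖ := by
  refine (norm_sub_le _ _).trans ?_
  rw [norm_mul, G.norm_o, one_mul]

/-- A point may have infinitely many neighbours, so the sum need not be finite. It is dominated
through the row sums of b, as ψ is bounded and φ has finite support. -/
theorem summable_form (φ ψ : X →₀ ℂ) :
    Summable fun p : X × X =>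
      (G.b p.1 p.2 : ℂ) * G.grad φ p.1 p.2 * starRingEnd ℂ (G.grad ψ p.1 p.2) := by
  have hS : ∃ S, ∀ x, ‖ψ x‖ ≤ S := by
    refine ⟨∑ x ∈ ψ.support, ‖ψ x‖, fun x => ?_⟩
    by_cases hx : x ∈ ψ.support
    · exact Finset.single_le_sum (f := fun x => ‖ψ x‖) (fun _ _ => norm_nonneg _) hx
    · rw [Finsupp.notMem_support_iff.1 hx, norm_zero]
      exact Finset.sum_nonneg fun _ _ => norm_nonneg _
  obtain ⟨S, hS⟩ := hS
  have hf : (fun x => ‖φ x‖).HasFiniteSupport :=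
    hasFiniteSupport_of_finsupp (φ := φ) fun x hx => by simp [hx]
  have h1 := (hasSum_prod_mul G.b_nonneg G.b_summable (fun x => norm_nonneg (φ x)) hf).summable
  have h2 := (hasSum_prod_mul' G.b_nonneg G.b_summable G.b_symm
    (fun x => norm_nonneg (φ x)) hf).summable
  refine Summable.of_norm_bounded ((h1.add h2).mul_right (S + S)) fun p => ?_
  rw [norm_mul, norm_mul, RCLike.norm_conj, Complex.norm_real, Real.norm_of_nonneg (G.b_nonneg _ _),
    ← mul_add]
  have hb := G.b_nonneg p.1 p.2
  gcongr
  · exact G.norm_grad_le φ _ _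
  · exact (G.norm_grad_le ψ _ _).trans (add_le_add (hS _) (hS _))

theorem summable_potential (φ ψ : X →₀ ℂ) :
    Summable fun x => (G.c x : ℂ) * φ x * starRingEnd ℂ (ψ x) :=
  summable_of_hasFiniteSupport (hasFiniteSupport_of_finsupp (φ := φ) fun x hx => by simp [hx])

theorem form_add_left (φ₁ φ₂ ψ : X →₀ ℂ) :
    G.form (φ₁ + φ₂) ψ = G.form φ₁ ψ + G.form φ₂ ψ := by
  simp only [form]
  rw [add_add_add_comm, ← mul_add,
    ← (G.summable_form φ₁ ψ).tsum_add (G.summable_form φ₂ ψ),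
    ← (G.summable_potential φ₁ ψ).tsum_add (G.summable_potential φ₂ ψ)]
  refine congrArg₂ (· + ·) (congrArg _ (tsum_congr fun p => ?_)) (tsum_congr fun x => ?_)
  · simp only [grad, Finsupp.add_apply]
    ring
  · simp only [Finsupp.add_apply]
    ring

theorem form_smul_left (z : ℂ) (φ ψ : X →₀ ℂ) : G.form (z • φ) ψ = z * G.form φ ψ := by
  simp only [form]
  rw [mul_add, mul_left_comm, ← tsum_mul_left (a := z), ← tsum_mul_left (a := z)]
  refine congrArg₂ (· + ·) (congrArg _ (tsum_congr fun p => ?_)) (tsum_congr fun x => ?_)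
  · simp only [grad, Finsupp.smul_apply, smul_eq_mul]
    ring
  · simp only [Finsupp.smul_apply, smul_eq_mul]
    ring

theorem form_conj (φ ψ : X →₀ ℂ) : starRingEnd ℂ (G.form φ ψ) = G.form ψ φ := by
  simp only [form, map_add, map_mul, Complex.conj_tsum]
  congr 2
  · simp [Complex.conj_ofNat]
  · congr 1
    ext p
    simp
    ring
  · ext x
    simp
    ring

theorem form_add_right (φ ψ₁ ψ₂ : X →₀ ℂ) :
    G.form φ (ψ₁ + ψ₂) = G.form φ ψ₁ + G.form φ ψ₂ := by
  rw [← form_conj, form_add_left, map_add, form_conj, form_conj]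

theorem form_smul_right (z : ℂ) (φ ψ : X →₀ ℂ) :
    G.form φ (z • ψ) = starRingEnd ℂ z * G.form φ ψ := by
  rw [← form_conj, form_smul_left, map_mul, form_conj]

/-- The commutator estimate for the form and a multiplication operator. -/
theorem abs_form_mul_sub_le {k : X → X → ℝ} (hk0 : ∀ x y, 0 ≤ k x y) (hks : ∀ x, Summable (k x))
    (hsymm : ∀ x y, k x y = k y x) (hkm : ∀ x, ∑' y, k x y ≤ G.m x) {η ρ : X → ℝ} {K : ℝ}
    (hK : 0 ≤ K)
    (h : ∀ x y, G.b x y * (η x - η y) ^ 2 ≤ 2 * K * (k x y * (ρ x * ρ y))) (hρ : ∀ x, 0 ≤ ρ x)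
    (φ : X →₀ ℂ) :
    |(G.form φ (mulFinsupp η (mulFinsupp η φ))).re - (G.form (mulFinsupp η φ) (mulFinsupp η φ)).re| ≤
      K * ∑' x, G.m x * ‖mulFinsupp ρ φ x‖ ^ 2 := by
  set a : X → ℝ := fun x => ‖mulFinsupp ρ φ x‖ ^ 2 with ha
  have ha0 : ∀ x, 0 ≤ a x := fun x => sq_nonneg _
  have haf : a.HasFiniteSupport := hasFiniteSupport_of_finsupp (φ := φ) fun x hx => by simp [ha, hx]
  have hsum := ((hasSum_prod_mul hk0 hks ha0 haf).add
    (hasSum_prod_mul' hk0 hks hsymm ha0 haf)).mul_left K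
  set T : X × X → ℂ := fun p => (G.b p.1 p.2 : ℂ) * G.grad φ p.1 p.2 *
      starRingEnd ℂ (G.grad (mulFinsupp η (mulFinsupp η φ)) p.1 p.2) -
    (G.b p.1 p.2 : ℂ) * G.grad (mulFinsupp η φ) p.1 p.2 *
      starRingEnd ℂ (G.grad (mulFinsupp η φ) p.1 p.2) with hT
  have hTs : Summable T := (G.summable_form _ _).sub (G.summable_form _ _)
  have hform : (G.form φ (mulFinsupp η (mulFinsupp η φ))).re -
      (G.form (mulFinsupp η φ) (mulFinsupp η φ)).re = 1 / 2 * ∑' p, (T p).re := by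
    rw [← Complex.sub_re, ← Complex.re_tsum hTs, hT,
      (G.summable_form _ _).tsum_sub (G.summable_form _ _)]
    -- As η is real, the potential terms agree and drop out of the commutator.
    have hc : ∀ x, (G.c x : ℂ) * φ x * starRingEnd ℂ (mulFinsupp η (mulFinsupp η φ) x) =
        (G.c x : ℂ) * mulFinsupp η φ x * starRingEnd ℂ (mulFinsupp η φ x) := fun x => by
      simp; ring
    simp only [form, hc, add_sub_add_right_eq_sub, ← mul_sub]
    rw [show (1 / 2 : ℂ) = ((1 / 2 : ℝ) : ℂ) by push_cast; rfl, Complex.re_ofReal_mul]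
  have hbound : ∀ p, ‖(T p).re‖ ≤ K * (k p.1 p.2 * a p.1 + k p.1 p.2 * a p.2) := by
    rintro ⟨x, y⟩
    -- Since |o| = 1, the terms in |φ(x)|² and |φ(y)|² cancel; the cross terms carry η(x)² + η(y)² -
    -- 2η(x)η(y).
    have hTre : (T (x, y)).re = -(G.b x y * (η x - η y) ^ 2 *
        (φ x * starRingEnd ℂ (G.o x y * φ y)).re) := by
      have h1 : Complex.normSq (G.o x y) = 1 := by
        rw [Complex.normSq_eq_norm_sq, G.norm_o]; norm_num
      rw [Complex.normSq_apply] at h1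
      simp only [hT, grad, mulFinsupp_apply]
      simp
      ring
    have h2 : |(φ x * starRingEnd ℂ (G.o x y * φ y)).re| ≤ ‖φ x‖ * ‖φ y‖ := by
      refine (Complex.abs_re_le_norm _).trans ?_
      rw [norm_mul, RCLike.norm_conj, norm_mul, G.norm_o, one_mul]
    have hb : 0 ≤ G.b x y * (η x - η y) ^ 2 := mul_nonneg (G.b_nonneg _ _) (sq_nonneg _)
    have hax : ∀ z, a z = (ρ z * ‖φ z‖) ^ 2 := fun z => by
      simp [ha, abs_of_nonneg (hρ z)]
    rw [Real.norm_eq_abs, hTre, abs_neg, abs_mul, abs_of_nonneg hb, hax, hax, ← mul_add]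
    calc _ ≤ 2 * K * (k x y * (ρ x * ρ y)) * (‖φ x‖ * ‖φ y‖) := by
          exact mul_le_mul (h x y) h2 (abs_nonneg _) (hb.trans (h x y))
      _ = K * (k x y * (2 * (ρ x * ‖φ x‖) * (ρ y * ‖φ y‖))) := by ring
      _ ≤ K * (k x y * ((ρ x * ‖φ x‖) ^ 2 + (ρ y * ‖φ y‖) ^ 2)) := by
          have := hk0 x y
          gcongr
          exact two_mul_le_add_sq _ _
  have hmain := tsum_of_norm_bounded hsum hbound
  rw [hform, abs_mul, ← Real.norm_eq_abs (∑' p, (T p).re)]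
  have hle : ∑' x, (∑' y, k x y) * a x ≤ ∑' x, G.m x * a x := by
    refine Summable.tsum_le_tsum (fun x => mul_le_mul_of_nonneg_right (hkm x) (ha0 x)) ?_ ?_
    · exact summable_mul_of_hasFiniteSupport haf _
    · exact summable_mul_of_hasFiniteSupport haf _
  calc |(1 / 2 : ℝ)| * _ ≤ 1 / 2 * (K * (∑' x, (∑' y, k x y) * a x + ∑' x, (∑' y, k x y) * a x)) := by
        rw [abs_of_nonneg (by norm_num : (0 : ℝ) ≤ 1 / 2)]
        gcongr
    _ = K * ∑' x, (∑' y, k x y) * a x := by ring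
    _ ≤ _ := by gcongr

/-- Multiplication by a bounded Lipschitz function is bounded in the form norm. No lower bound of
the potential is needed, as the form is positive on the product with `(2 S² - η²)^(1/2)` as well. -/
theorem form_mul_le (hpos : G.IsPositive) {k : X → X → ℝ} (hk0 : ∀ x y, 0 ≤ k x y)
    (hks : ∀ x, Summable (k x)) (hsymm : ∀ x y, k x y = k y x) (hkm : ∀ x, ∑' y, k x y ≤ G.m x)
    {η : X → ℝ} {K S : ℝ} (hK : 0 ≤ K) (h : ∀ x y, G.b x y * (η x - η y) ^ 2 ≤ 2 * K * k x y)
    (hη0 : ∀ x, 0 ≤ η x) (hS : 0 < S) (hηS : ∀ x, η x ≤ S) (φ : X →₀ ℂ) :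
    (G.form (mulFinsupp η φ) (mulFinsupp η φ)).re ≤
      2 * S ^ 2 * (G.form φ φ).re + 2 * K * ∑' x, G.m x * ‖φ x‖ ^ 2 := by
  -- The factor 2 gives χ ≥ S ≥ η. As η² + χ² is constant, (χ(x) + χ(y))|χ(x) - χ(y)| = (η(x) +
  -- η(y))|η(x) - η(y)|, so χ varies no more than η.
  set χ : X → ℝ := fun x => √(2 * S ^ 2 - η x ^ 2) with hχ
  have hsq : ∀ x, χ x ^ 2 = 2 * S ^ 2 - η x ^ 2 := fun x =>
    Real.sq_sqrt (by nlinarith [hη0 x, hηS x])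
  have hχS : ∀ x, S ≤ χ x := fun x =>
    Real.le_sqrt_of_sq_le (by nlinarith [hη0 x, hηS x])
  have hχ' : ∀ x y, G.b x y * (χ x - χ y) ^ 2 ≤ 2 * K * k x y := fun x y => by
    refine le_trans (mul_le_mul_of_nonneg_left ?_ (G.b_nonneg x y)) (h x y)
    rw [sq_le_sq]
    have h1 : (χ x + χ y) * |χ x - χ y| = (η x + η y) * |η x - η y| := by
      rw [← abs_of_nonneg (by linarith [hχS x, hχS y] : 0 ≤ χ x + χ y),
        ← abs_of_nonneg (by linarith [hη0 x, hη0 y] : 0 ≤ η x + η y), ← abs_mul, ← abs_mul,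
        ← abs_neg]
      congr 1
      linear_combination hsq y - hsq x
    have h2 : (η x + η y) * |η x - η y| ≤ (χ x + χ y) * |η x - η y| := by
      gcongr
      · linarith [hηS x, hχS x]
      · linarith [hηS y, hχS y]
    rw [← h1] at h2
    exact le_of_mul_le_mul_left h2 (by linarith [hχS x, hχS y])
  have hone : mulFinsupp (fun _ => 1) φ = φ := by ext x; simp
  have key : ∀ θ : X → ℝ, (∀ x y, G.b x y * (θ x - θ y) ^ 2 ≤ 2 * K * k x y) →
      (G.form (mulFinsupp θ φ) (mulFinsupp θ φ)).re ≤
        (G.form φ (mulFinsupp θ (mulFinsupp θ φ))).re + K * ∑' x, G.m x * ‖φ x‖ ^ 2 := by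
    intro θ hθ
    have := G.abs_form_mul_sub_le hk0 hks hsymm hkm (η := θ) (ρ := fun _ => 1) hK
      (by simpa using hθ) (fun _ => zero_le_one) φ
    rw [hone] at this
    linarith [(abs_le.1 this).1]
  have hadd : mulFinsupp η (mulFinsupp η φ) + mulFinsupp χ (mulFinsupp χ φ) =
      ((2 * S ^ 2 : ℝ) : ℂ) • φ := by
    ext x
    have : ((χ x : ℝ) : ℂ) ^ 2 = ((2 * S ^ 2 - η x ^ 2 : ℝ) : ℂ) := by
      rw [← hsq x]; push_cast; rfl
    simp only [Finsupp.add_apply, mulFinsupp_apply, Finsupp.smul_apply, smul_eq_mul]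
    push_cast at this ⊢
    linear_combination φ x * this
  have hform := congrArg Complex.re (congrArg (G.form φ) hadd)
  rw [form_add_right, form_smul_right, Complex.conj_ofReal, Complex.re_ofReal_mul,
    Complex.add_re] at hform
  -- Adding the estimates for η and χ bounds Q(ηφ) + Q(χφ) by 2S²Q(φ) + 2K‖φ‖²; then Q(χφ) ≥ 0 is
  -- dropped.
  linarith [key η h, key χ hχ', hpos (mulFinsupp χ φ)]

end MagneticSchrodingerGraph

namespace MagneticSchrodingerGraph

theorem norm_ofReal_mul_le {X : Type*} {w : X → ℝ} {C : ℝ} (hw : ∀ x, |w x| ≤ C) (f : X → ℂ) (x : X) :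
    ‖(w x : ℂ) * f x‖ ≤ C * ‖f x‖ := by
  rw [norm_mul, Complex.norm_real]
  exact mul_le_mul_of_nonneg_right (hw x) (norm_nonneg _)

variable {X : Type*} [MeasurableSpace X] [DiscreteMeasurableSpace X]
variable (G : MagneticSchrodingerGraph X)

/-! ### The Hilbert space -/

/-- Every point has positive mass, so only the empty set is null; hence elements of ℓ² have
well-defined values and supports. -/
theorem ae_measure_iff {p : X → Prop} : (∀ᵐ x ∂G.measure, p x) ↔ ∀ x, p x := by
  refine ⟨fun h x => ?_, fun h => Filter.Eventually.of_forall h⟩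
  by_contra hx
  rw [ae_iff, measure, Measure.sum_apply _ (MeasurableSet.of_discrete), ENNReal.tsum_eq_zero] at h
  have := h x
  have hm := G.m_pos x
  simp [hx] at this
  linarith

theorem eq_of_ae_eq {Y : Type*} {f g : X → Y} (h : f =ᵐ[G.measure] g) : f = g :=
  funext (G.ae_measure_iff.1 h)

theorem coe_incl (φ : X →₀ ℂ) : (G.incl φ : X → ℂ) = φ :=
  G.eq_of_ae_eq (MemLp.coeFn_toLp _)

/-- The inclusion of the finitely supported functions as a linear map. -/
noncomputable def inclLinear : (X →₀ ℂ) →ₗ[ℂ] G.L2 where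
  toFun := G.incl
  map_add' _ _ := rfl
  map_smul' _ _ := rfl

theorem incl_injective : Function.Injective G.incl := fun φ ψ h => by
  have := congrArg (fun f : G.L2 => (f : X → ℂ)) h
  simp only [coe_incl] at this
  exact DFunLike.coe_injective this

theorem norm_incl_sq (φ : X →₀ ℂ) : ‖G.incl φ‖ ^ 2 = ∑' x, G.m x * ‖φ x‖ ^ 2 := by
  have h1 : ((‖G.incl φ‖ ^ 2 : ℝ) : ℂ) = ∫ x, ((‖φ x‖ ^ 2 : ℝ) : ℂ) ∂G.measure := by
    have := L2.inner_def (𝕜 := ℂ) (G.incl φ) (G.incl φ)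
    rw [inner_self_eq_norm_sq_to_K, coe_incl] at this
    simp only [inner_self_eq_norm_sq_to_K] at this
    simpa using this
  rw [integral_complex_ofReal] at h1
  have h2 : ‖G.incl φ‖ ^ 2 = ∫ x, ‖φ x‖ ^ 2 ∂G.measure := by exact_mod_cast h1
  have hint : Integrable (fun x => ‖φ x‖ ^ 2) G.measure := 
    (G.memLp_finsupp φ).integrable_norm_pow two_ne_zero
  rw [h2]
  rw [measure] at hint ⊢
  rw [← (hasSum_integral_measure hint).tsum_eq]
  congr 1
  ext x
  rw [integral_smul_measure, integral_dirac, ENNReal.toReal_ofReal (G.m_pos x).le, smul_eq_mul]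

theorem norm_incl_single (x : X) : ‖G.incl (Finsupp.single x 1)‖ = √(G.m x) := by
  rw [← Real.sqrt_sq (norm_nonneg _), norm_incl_sq, tsum_eq_single x]
  · simp
  · intro y hy
    simp [hy]

theorem memLp_ofReal_mul {w : X → ℝ} {C : ℝ} (hw : ∀ x, |w x| ≤ C) (f : G.L2) :
    MemLp (fun x => (w x : ℂ) * f x) 2 G.measure :=
  (Lp.memLp f).of_le_mul (c := C) Measurable.of_discrete.aestronglyMeasurable
    (Filter.Eventually.of_forall (norm_ofReal_mul_le hw f))

/-- Multiplication by a bounded real function as an operator on `ℓ²(X, m)`. -/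
noncomputable def mulL2 (w : X → ℝ) (C : ℝ) (hw : ∀ x, |w x| ≤ C) : G.L2 →L[ℂ] G.L2 :=
  LinearMap.mkContinuous
    { toFun := fun f => (G.memLp_ofReal_mul hw f).toLp _
      map_add' := fun f g => by
        rw [← MemLp.toLp_add]
        refine MemLp.toLp_congr _ _ ?_
        filter_upwards [Lp.coeFn_add f g] with x hx
        rw [hx, Pi.add_apply, Pi.add_apply, mul_add]
      map_smul' := fun z f => by
        rw [RingHom.id_apply, ← MemLp.toLp_const_smul]
        refine MemLp.toLp_congr _ _ ?_
        filter_upwards [Lp.coeFn_smul z f] with x hx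
        rw [hx, Pi.smul_apply, Pi.smul_apply, smul_eq_mul, smul_eq_mul, mul_left_comm] } C
    fun f => Lp.norm_le_mul_norm_of_ae_le_mul <| by
      filter_upwards [MemLp.coeFn_toLp (G.memLp_ofReal_mul hw f)] with x hx
      change ‖(G.memLp_ofReal_mul hw f).toLp _ x‖ ≤ _
      rw [hx]
      exact norm_ofReal_mul_le hw f x

theorem coe_mulL2 (w : X → ℝ) (C : ℝ) (hw : ∀ x, |w x| ≤ C) (f : G.L2) :
    (G.mulL2 w C hw f : X → ℂ) = fun x => (w x : ℂ) * f x :=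
  G.eq_of_ae_eq (MemLp.coeFn_toLp (G.memLp_ofReal_mul hw f))

theorem norm_mulL2_apply_le (w : X → ℝ) (C : ℝ) (hw : ∀ x, |w x| ≤ C) (f : G.L2) :
    ‖G.mulL2 w C hw f‖ ≤ C * ‖f‖ :=
  Lp.norm_le_mul_norm_of_ae_le_mul <| Filter.Eventually.of_forall fun x => by
    rw [coe_mulL2]
    exact norm_ofReal_mul_le hw f x

theorem inner_mulL2 (w : X → ℝ) (C : ℝ) (hw : ∀ x, |w x| ≤ C) (f g : G.L2) :
    inner ℂ (G.mulL2 w C hw f) g = inner ℂ f (G.mulL2 w C hw g) := by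
  rw [L2.inner_def, L2.inner_def, coe_mulL2, coe_mulL2]
  congr 1
  ext x
  simp
  ring

theorem incl_mulFinsupp (w : X → ℝ) (C : ℝ) (hw : ∀ x, |w x| ≤ C) (φ : X →₀ ℂ) :
    G.incl (mulFinsupp w φ) = G.mulL2 w C hw (G.incl φ) := by
  refine Lp.ext (Filter.Eventually.of_forall fun x => ?_)
  rw [coe_incl, coe_mulL2, coe_incl, mulFinsupp_apply]

end MagneticSchrodingerGraph

/-! ### Exponential weights -/

namespace MagneticSchrodinger

/-- Convexity of sinh on [0, ∞) together with sinh 0 = 0. -/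
theorem sinh_mul_le {θ x : ℝ} (hθ0 : 0 ≤ θ) (hθ1 : θ ≤ 1) (hx : 0 ≤ x) :
    Real.sinh (θ * x) ≤ θ * Real.sinh x := by
  have hconv : ConvexOn ℝ (Set.Ici 0) Real.sinh := by
    refine MonotoneOn.convexOn_of_deriv (convex_Ici 0) Real.continuous_sinh.continuousOn
      Real.differentiable_sinh.differentiableOn ?_
    rw [Real.deriv_sinh, interior_Ici]
    intro a ha b hb hab
    exact Real.cosh_le_cosh.2 (by rwa [abs_of_pos ha, abs_of_pos hb])
  have := hconv.2 (x := 0) (y := x) Set.self_mem_Ici hx (sub_nonneg.2 hθ1) hθ0 (by ring)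
  simpa using this

theorem cosh_sub_one_eq (x : ℝ) : Real.cosh x - 1 = 2 * Real.sinh (x / 2) ^ 2 := by
  have h1 := Real.cosh_two_mul (x / 2)
  rw [mul_div_cancel₀ x two_ne_zero] at h1
  linarith [Real.cosh_sq (x / 2)]

/-- The quotient (cosh(κδ) - 1)/δ² is largest at δ = s: by cosh x - 1 = 2 sinh²(x/2) this reduces to
`sinh_mul_le`. Here the jump size enters the constant. -/
theorem cosh_sub_one_le {κ s δ x : ℝ} (hκ : 0 ≤ κ) (hs : 0 < s) (hδ : 0 ≤ δ) (hδs : δ ≤ s)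
    (hx : |x| ≤ κ * δ) : Real.cosh x - 1 ≤ (Real.cosh (κ * s) - 1) / s ^ 2 * δ ^ 2 := by
  have h1 : Real.cosh x ≤ Real.cosh (κ * δ) :=
    Real.cosh_le_cosh.2 (by rwa [abs_of_nonneg (mul_nonneg hκ hδ)])
  have h2 := sinh_mul_le (div_nonneg hδ hs.le) ((div_le_one hs).2 hδs)
    (by positivity : 0 ≤ κ * s / 2)
  rw [show δ / s * (κ * s / 2) = κ * δ / 2 by field_simp] at h2
  have h3 : 0 ≤ Real.sinh (κ * δ / 2) := Real.sinh_nonneg_iff.2 (by positivity)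
  calc Real.cosh x - 1 ≤ Real.cosh (κ * δ) - 1 := by linarith
    _ = 2 * Real.sinh (κ * δ / 2) ^ 2 := cosh_sub_one_eq _
    _ ≤ 2 * (δ / s * Real.sinh (κ * s / 2)) ^ 2 := by gcongr
    _ = _ := by rw [cosh_sub_one_eq]; ring

theorem exp_sub_exp_sq (a b : ℝ) :
    (Real.exp a - Real.exp b) ^ 2 = 2 * (Real.cosh (a - b) - 1) * (Real.exp a * Real.exp b) := by
  rw [Real.cosh_eq, neg_sub, Real.exp_sub, Real.exp_sub]
  field_simp
  ring

theorem abs_exp_sub_exp_le {a b c : ℝ} (ha : a ≤ c) (hb : b ≤ c) :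
    |Real.exp a - Real.exp b| ≤ Real.exp c * |a - b| := by
  wlog hab : b ≤ a generalizing a b
  · rw [abs_sub_comm, abs_sub_comm a]
    exact this hb ha (le_of_not_ge hab)
  rw [abs_of_nonneg (sub_nonneg.2 (Real.exp_le_exp.2 hab)), abs_of_nonneg (sub_nonneg.2 hab)]
  have h1 : Real.exp b = Real.exp a * Real.exp (b - a) := by rw [← Real.exp_add]; congr 1; ring
  have h2 := Real.add_one_le_exp (b - a)
  calc Real.exp a - Real.exp b = Real.exp a * (1 - Real.exp (b - a)) := by rw [h1]; ring
    _ ≤ Real.exp a * (a - b) := mul_le_mul_of_nonneg_left (by linarith) (Real.exp_pos a).le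
    _ ≤ _ := by gcongr

end MagneticSchrodinger

/-! ### The weighted semigroup estimate on the graph -/

namespace MagneticSchrodingerGraph

variable {X : Type*} (G : MagneticSchrodingerGraph X) {d : X → X → ℝ≥0∞}

theorem summable_intrinsic (hd : IsIntrinsicMetric G d) (x : X) :
    Summable (fun y => G.b x y * (d x y).toReal ^ 2) ∧
      ∑' y, G.b x y * (d x y).toReal ^ 2 ≤ G.m x := by
  have hle := hd.sum_le x
  have hne : ∑' y, ENNReal.ofReal (G.b x y) * d x y ^ 2 ≠ ∞ :=
    ne_top_of_le_ne_top ENNReal.ofReal_ne_top hle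
  have heq : ∀ y, G.b x y * (d x y).toReal ^ 2 =
      (ENNReal.ofReal (G.b x y) * d x y ^ 2).toReal := fun y => by
    rw [ENNReal.toReal_mul, ENNReal.toReal_ofReal (G.b_nonneg x y), ENNReal.toReal_pow]
  simp only [heq]
  refine ⟨ENNReal.summable_toReal hne, ?_⟩
  rw [← ENNReal.tsum_toReal_eq fun y => ENNReal.ne_top_of_tsum_ne_top hne y]
  exact ENNReal.toReal_le_of_le_ofReal (G.m_pos x).le hle

theorem le_jumpSize {x y : X} (hb : 0 < G.b x y) : d x y ≤ jumpSize G d :=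
  le_iSup_of_le x <| le_iSup_of_le y <| le_iSup_of_le hb le_rfl

variable [MeasurableSpace X] [DiscreteMeasurableSpace X]

/-- The weighted estimate of the semigroup for the weight `exp (κ ρ)` with `ρ` bounded and
Lipschitz. -/
theorem norm_exp_mul_semigroup_le [Nonempty X] (hpos : G.IsPositive) (hclos : G.IsClosable)
    (hd : IsIntrinsicMetric G d) {s : ℝ} (hs : 0 < s)
    (hds : ∀ x y, 0 < G.b x y → (d x y).toReal ≤ s) {κ N : ℝ} (hκ : 0 ≤ κ) {ρ : X → ℝ}
    (hρN : ∀ x, ρ x ≤ N)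
    (hρ : ∀ x y, 0 < G.b x y → |ρ x - ρ y| ≤ (d x y).toReal) {C : ℝ}
    (hC : ∀ x, |Real.exp (κ * ρ x)| ≤ C) {t : ℝ} (ht : 0 < t) (f : G.L2) :
    ‖G.mulL2 (fun x => Real.exp (κ * ρ x)) C hC (G.semigroup t f)‖ ≤
      Real.exp (-(G.bottom - (Real.cosh (κ * s) - 1) / s ^ 2) * t) *
        ‖G.mulL2 (fun x => Real.exp (κ * ρ x)) C hC f‖ := by
  obtain ⟨W, _, _, _, j, J, h, hJ⟩ := exists_isFormCompletion G.inclLinear G.incl_injective G.form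
    G.form_add_left G.form_smul_left G.form_conj hpos hclos
  replace hJ : (fun φ => J (j φ)) = G.incl := hJ
  have hJ' : ∀ φ, J (j φ) = G.incl φ := congrFun hJ
  set K := (Real.cosh (κ * s) - 1) / s ^ 2 with hKdef
  have hK : 0 ≤ K := div_nonneg (sub_nonneg.2 (Real.one_le_cosh _)) (sq_nonneg s)
  set ω : X → ℝ := fun x => Real.exp (κ * ρ x) with hω
  set k : X → X → ℝ := fun x y => G.b x y * (d x y).toReal ^ 2 with hk
  have hk0 : ∀ x y, 0 ≤ k x y := fun x y => mul_nonneg (G.b_nonneg x y) (sq_nonneg _)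
  have hks : ∀ x, Summable (k x) := fun x => (G.summable_intrinsic hd x).1
  have hkm : ∀ x, ∑' y, k x y ≤ G.m x := fun x => (G.summable_intrinsic hd x).2
  have hsymm : ∀ x y, k x y = k y x := fun x y => by simp only [hk, G.b_symm x y, hd.symm x y]
  have hlip : ∀ x y, G.b x y * (ω x - ω y) ^ 2 ≤ 2 * K * (k x y * (ω x * ω y)) := fun x y => by
    rcases (G.b_nonneg x y).eq_or_lt with hb | hb
    · simp [hk, ← hb]
    have h1 : Real.cosh (κ * ρ x - κ * ρ y) - 1 ≤ K * (d x y).toReal ^ 2 := by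
      refine cosh_sub_one_le hκ hs ENNReal.toReal_nonneg (hds x y hb) ?_
      rw [← mul_sub, abs_mul, abs_of_nonneg hκ]
      exact mul_le_mul_of_nonneg_left (hρ x y hb) hκ
    have h2 : 0 < Real.exp (κ * ρ x) * Real.exp (κ * ρ y) := by positivity
    simp only [hω, hk]
    rw [exp_sub_exp_sq]
    calc _ ≤ G.b x y * (2 * (K * (d x y).toReal ^ 2) *
          (Real.exp (κ * ρ x) * Real.exp (κ * ρ y))) := by gcongr
      _ = _ := by ring
  set η : X → ℝ := fun x => ω x ^ 2 with hη
  set S := Real.exp (2 * κ * N) with hS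
  have hηexp : ∀ x, η x = Real.exp (2 * κ * ρ x) := fun x => by
    simp only [hη, hω]
    rw [← Real.exp_nat_mul]
    congr 1
    push_cast
    ring
  have hηS : ∀ x, η x ≤ S := fun x => by
    rw [hηexp, hS]
    have := hρN x
    gcongr
  have hS0 : 0 < S := Real.exp_pos _
  -- A crude Lipschitz constant of η = ω²; it only ensures that multiplication by η extends to W and
  -- does not enter the final bound.
  set K' := (S * (2 * κ)) ^ 2 / 2 with hK'
  have hlip' : ∀ x y, G.b x y * (η x - η y) ^ 2 ≤ 2 * K' * k x y := fun x y => by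
    rcases (G.b_nonneg x y).eq_or_lt with hb | hb
    · simp [hk, ← hb]
    have h1 : |η x - η y| ≤ S * (2 * κ) * (d x y).toReal := by
      rw [hηexp, hηexp]
      have hx := hρN x
      have hy := hρN y
      refine (abs_exp_sub_exp_le (c := 2 * κ * N) (by gcongr) (by gcongr)).trans ?_
      rw [← mul_sub, abs_mul, abs_of_nonneg (by positivity : 0 ≤ 2 * κ), mul_assoc S]
      refine mul_le_mul_of_nonneg_left ?_ hS0.le
      exact mul_le_mul_of_nonneg_left (hρ x y hb) (by positivity)
    have h2 : (η x - η y) ^ 2 ≤ (S * (2 * κ) * (d x y).toReal) ^ 2 :=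
      sq_le_sq.2 (h1.trans (le_abs_self _))
    calc _ ≤ G.b x y * (S * (2 * κ) * (d x y).toReal) ^ 2 := by gcongr
      _ = _ := by simp only [hk, hK']; ring
  have hmul : ∀ φ : X →₀ ℂ, mulFinsupp ω (mulFinsupp ω φ) = mulFinsupp η φ := fun φ => by
    ext x
    simp [hη]
    ring
  have hnorm : ∀ φ, ‖j φ‖ ^ 2 = (G.form φ φ).re + ‖G.incl φ‖ ^ 2 := fun φ => by
    rw [form_self_eq h.inner_eq, Complex.ofReal_re, hJ']
    ring
  have hηabs : ∀ x, |η x| ≤ S := fun x => by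
    rw [abs_of_nonneg (sq_nonneg _)]
    exact hηS x
  have hM₂ : ∀ φ, ‖(j ∘ₗ mulFinsupp η) φ‖ ≤ √(2 * S ^ 2 + 2 * K' + S ^ 2) * ‖j φ‖ := fun φ => by
    rw [LinearMap.comp_apply]
    refine le_of_sq_le_sq ?_ (by positivity)
    rw [mul_pow, Real.sq_sqrt (by positivity), hnorm, hnorm]
    have h1 := G.form_mul_le hpos hk0 hks hsymm hkm (by positivity) hlip' (fun x => sq_nonneg _)
      hS0 hηS φ
    rw [← norm_incl_sq] at h1
    have h2 : ‖G.incl (mulFinsupp η φ)‖ ^ 2 ≤ S ^ 2 * ‖G.incl φ‖ ^ 2 := by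
      rw [G.incl_mulFinsupp η S hηabs, ← mul_pow]
      gcongr
      exact G.norm_mulL2_apply_le η S hηabs _
    have h3 := hpos φ
    have h4 : 0 ≤ (2 * K' + S ^ 2) * (G.form φ φ).re := by positivity
    have h5 : 0 ≤ 2 * S ^ 2 * ‖G.incl φ‖ ^ 2 := by positivity
    linarith
  set M := G.mulL2 ω C hC with hM
  set M₂ : W →L[ℂ] W := (j ∘ₗ mulFinsupp η).extendOfNorm j with hM₂def
  have hM₂j : ∀ φ, M₂ (j φ) = j (mulFinsupp η φ) := fun φ =>
    LinearMap.extendOfNorm_eq h.dense ⟨_, hM₂⟩ φ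
  have hJM : ∀ v, J (M₂ v) = M (M (J v)) := by
    refine fun v => h.dense.induction_on (p := fun v => J (M₂ v) = M (M (J v))) v
      (isClosed_eq (by fun_prop) (by fun_prop)) fun φ => ?_
    rw [hM₂j, hJ', hJ', ← hmul, G.incl_mulFinsupp ω C hC, G.incl_mulFinsupp ω C hC]
  have hJ0 : J ≠ 0 := fun h0 => by
    obtain ⟨x⟩ := ‹Nonempty X›
    have h1 := G.norm_incl_single x
    rw [← hJ', h0, zero_apply, norm_zero] at h1
    exact (Real.sqrt_pos.2 (G.m_pos x)).ne h1
  have hbot : ∀ w, G.bottom * ‖J w‖ ^ 2 ≤ ‖w‖ ^ 2 - ‖J w‖ ^ 2 := fun w => by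
    have := h.bottom_le_form hJ0 w
    rw [hJ] at this
    exact this
  -- Both sides are continuous on W, so finitely supported functions suffice; there the commutator
  -- estimate with weight ω is combined with Q(ωφ) ≥ λ₂‖ωφ‖².
  have ha : ∀ v, (G.bottom - K) * ‖M (J v)‖ ^ 2 ≤ (inner ℂ (M₂ v) v).re - ‖M (J v)‖ ^ 2 := by
    refine fun v => h.dense.induction_on
      (p := fun v => (G.bottom - K) * ‖M (J v)‖ ^ 2 ≤ (inner ℂ (M₂ v) v).re - ‖M (J v)‖ ^ 2) v
      (isClosed_le (by fun_prop) (by fun_prop)) fun φ => ?_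
    have h1 := G.abs_form_mul_sub_le hk0 hks hsymm hkm hK hlip (fun x => (Real.exp_pos _).le) φ
    rw [← norm_incl_sq] at h1
    have h2 := hbot (j (mulFinsupp ω φ))
    rw [hnorm, hJ', add_sub_cancel_right] at h2
    have h3 : (inner ℂ (M₂ (j φ)) (j φ)).re =
        (G.form φ (mulFinsupp ω (mulFinsupp ω φ))).re + ‖G.incl (mulFinsupp ω φ)‖ ^ 2 := by
      rw [hM₂j, h.inner_eq, ← hmul, hJ', hJ', G.incl_mulFinsupp ω C hC, G.inner_mulL2,
        ← G.incl_mulFinsupp, Complex.add_re, inner_self_eq_norm_sq_to_K]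
      simp [← Complex.ofReal_pow]
    rw [h3, hJ', ← G.incl_mulFinsupp]
    linarith [(abs_le.1 h1).1]
  have := h.norm_weighted_expNeg_le (G.inner_mulL2 ω C hC) hJM ha ht f
  rw [hJ] at this
  exact this

end MagneticSchrodingerGraph

/-! ### The truncated distance and the optimal rate -/

namespace MagneticSchrodinger

variable {X : Type*} {d : X → X → ℝ≥0∞}

/-- The distance to the set `A`, truncated at `N`. -/
noncomputable def truncDist (d : X → X → ℝ≥0∞) (A : Set X) (N : ℝ) (y : X) : ℝ :=
  (min (⨅ z ∈ A, d z y) (ENNReal.ofReal N)).toReal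

theorem truncDist_le {A : Set X} {N : ℝ} (hN : 0 ≤ N) (y : X) : truncDist d A N y ≤ N :=
  ENNReal.toReal_le_of_le_ofReal hN (min_le_right _ _)

theorem truncDist_eq_zero (hd : IsPseudoMetric d) {A : Set X} {N : ℝ} {x : X} (hx : x ∈ A) :
    truncDist d A N x = 0 := by
  have : ⨅ z ∈ A, d z x = 0 := le_antisymm ((iInf₂_le x hx).trans (hd.self x).le) zero_le
  simp [truncDist, this]

theorem truncDist_eq {A B : Set X} {N : ℝ} (hN : 0 ≤ N) (hAB : ENNReal.ofReal N ≤ setDist d A B)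
    {y : X} (hy : y ∈ B) : truncDist d A N y = N := by
  have : ENNReal.ofReal N ≤ ⨅ z ∈ A, d z y :=
    hAB.trans (iInf₂_mono fun z _ => iInf₂_le y hy)
  rw [truncDist, min_eq_right this, ENNReal.toReal_ofReal hN]

theorem truncDist_le_add (hd : IsPseudoMetric d) {A : Set X} {N : ℝ} {x y : X} (hxy : d x y ≠ ∞) :
    truncDist d A N y ≤ truncDist d A N x + (d x y).toReal := by
  have hfin : min (⨅ z ∈ A, d z x) (ENNReal.ofReal N) ≠ ∞ :=
    ne_top_of_le_ne_top ENNReal.ofReal_ne_top (min_le_right _ _)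
  rw [truncDist, truncDist, ← ENNReal.toReal_add hfin hxy]
  refine ENNReal.toReal_mono (ENNReal.add_ne_top.2 ⟨hfin, hxy⟩) ?_
  rw [min_add]
  refine min_le_min ?_ le_self_add
  simp only [ENNReal.iInf_add]
  exact iInf₂_mono fun z _ => hd.triangle z x y

theorem abs_truncDist_sub_le (hd : IsPseudoMetric d) {A : Set X} {N : ℝ} {x y : X}
    (hxy : d x y ≠ ∞) : |truncDist d A N x - truncDist d A N y| ≤ (d x y).toReal := by
  have h1 := truncDist_le_add hd (A := A) (N := N) hxy
  have h2 := truncDist_le_add hd (A := A) (N := N) (hd.symm x y ▸ hxy)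
  rw [hd.symm y x] at h2
  exact abs_le.2 ⟨by linarith, by linarith⟩

/-- The optimal choice of the exponential rate. -/
theorem exponent_arsinh_eq {s t N : ℝ} (hs : 0 < s) (ht : 0 < t) (lam : ℝ) :
    -(lam - (Real.cosh (Real.arsinh (s * N / t) / s * s) - 1) / s ^ 2) * t -
      Real.arsinh (s * N / t) / s * N = -lam * t - t / s ^ 2 * zeta (s * N / t) := by
  rw [div_mul_cancel₀ _ hs.ne', Real.cosh_arsinh, zeta]
  field_simp
  ring

end MagneticSchrodinger

/-! ### The Davies–Gaffney–Grigor'yan estimates -/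

namespace MagneticSchrodingerGraph

variable {X : Type*} [MeasurableSpace X] [DiscreteMeasurableSpace X]
variable (G : MagneticSchrodingerGraph X) {d : X → X → ℝ≥0∞}

/-- The weight fixes f and multiplies g by exp(κN). Moving it across the inner product onto g gains
exp(-κN) at no cost in ‖f‖. -/
theorem norm_inner_semigroup_le_exp [Nonempty X] (hpos : G.IsPositive) (hclos : G.IsClosable)
    (hd : IsIntrinsicMetric G d) (hs_pos : 0 < jumpSize G d) (hs_fin : jumpSize G d < ∞) {κ N : ℝ}
    (hκ : 0 ≤ κ) (hN : 0 ≤ N) {t : ℝ} (ht : 0 < t) (f g : G.L2)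
    (hdist : ENNReal.ofReal N ≤ setDist d (Function.support f) (Function.support g)) :
    ‖inner ℂ g (G.semigroup t f)‖ ≤
      Real.exp (-(G.bottom - (Real.cosh (κ * (jumpSize G d).toReal) - 1) /
        (jumpSize G d).toReal ^ 2) * t - κ * N) * ‖f‖ * ‖g‖ := by
  set ρ := truncDist d (Function.support f) N with hρ
  have hC : ∀ x, |Real.exp (κ * ρ x)| ≤ Real.exp (κ * N) := fun x => by
    rw [abs_of_pos (Real.exp_pos _)]
    have : ρ x ≤ N := truncDist_le hN x
    gcongr
  have hdtop : ∀ x y, 0 < G.b x y → d x y ≠ ∞ := fun x y hb =>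
    ((G.le_jumpSize hb).trans_lt hs_fin).ne
  have hmain := G.norm_exp_mul_semigroup_le hpos hclos hd
    (ENNReal.toReal_pos hs_pos.ne' hs_fin.ne)
    (fun x y hb => ENNReal.toReal_mono hs_fin.ne (G.le_jumpSize hb)) hκ
    (fun x => truncDist_le hN x)
    (fun x y hb => abs_truncDist_sub_le hd.toIsPseudoMetric (hdtop x y hb)) hC ht f
  set M := G.mulL2 (fun x => Real.exp (κ * ρ x)) (Real.exp (κ * N)) hC with hM
  have hf : M f = f := by
    refine Lp.ext (Filter.Eventually.of_forall fun x => ?_)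
    rw [hM, coe_mulL2]
    by_cases hx : f x = 0
    · simp [hx]
    · simp [hρ, truncDist_eq_zero hd.toIsPseudoMetric (Function.mem_support.2 hx)]
  have hg : M g = ((Real.exp (κ * N) : ℝ) : ℂ) • g := by
    refine Lp.ext ?_
    filter_upwards [Lp.coeFn_smul ((Real.exp (κ * N) : ℝ) : ℂ) g] with x hx
    rw [hx, hM, coe_mulL2, Pi.smul_apply, smul_eq_mul]
    by_cases h0 : g x = 0
    · simp [h0]
    · simp only [hρ, truncDist_eq hN hdist (Function.mem_support.2 h0)]
  have h1 : ‖inner ℂ g (M (G.semigroup t f))‖ =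
      Real.exp (κ * N) * ‖inner ℂ g (G.semigroup t f)‖ := by
    rw [hM, ← inner_mulL2, ← hM, hg, inner_smul_left, norm_mul, RCLike.norm_conj,
      Complex.norm_real, Real.norm_of_nonneg (Real.exp_pos _).le]
  have h2 := norm_inner_le_norm (𝕜 := ℂ) g (M (G.semigroup t f))
  rw [hf] at hmain
  rw [Real.exp_sub, div_mul_eq_mul_div, div_mul_eq_mul_div, le_div_iff₀ (Real.exp_pos _), mul_comm,
    ← h1]
  refine h2.trans ?_
  rw [mul_comm]
  gcongr

theorem norm_inner_semigroup_le [Nonempty X] (hpos : G.IsPositive) (hclos : G.IsClosable)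
    (hd : IsIntrinsicMetric G d) (hs_pos : 0 < jumpSize G d) (hs_fin : jumpSize G d < ∞)
    {t : ℝ} (ht : 0 < t) (f g : G.L2) :
    ‖inner ℂ g (G.semigroup t f)‖ ≤ dggBound G.bottom t (jumpSize G d).toReal
      (setDist d (Function.support f) (Function.support g)) * ‖f‖ * ‖g‖ := by
  have hs : 0 < (jumpSize G d).toReal := ENNReal.toReal_pos hs_pos.ne' hs_fin.ne
  rw [dggBound]
  split_ifs with htop
  -- At infinite distance every N is allowed: κ = 1 is fixed and N → ∞.
  · have hlim : ∀ A : ℝ, Tendsto (fun N : ℕ => Real.exp (A - 1 * N) * ‖f‖ * ‖g‖) atTop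
        (𝓝 (0 * ‖f‖ * ‖g‖)) := fun A => by
      refine Tendsto.mul_const _ (Tendsto.mul_const _ ?_)
      simp only [one_mul]
      exact Real.tendsto_exp_atBot.comp (tendsto_atBot_add_const_left _ _
        (tendsto_neg_atTop_atBot.comp tendsto_natCast_atTop_atTop))
    exact ge_of_tendsto' (hlim _) fun N => G.norm_inner_semigroup_le_exp hpos hclos hd hs_pos hs_fin
      zero_le_one (Nat.cast_nonneg N) ht f g (htop ▸ le_top)
  · set N := (setDist d (Function.support f) (Function.support g)).toReal with hN
    have hN0 : 0 ≤ N := ENNReal.toReal_nonneg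
    -- This κ minimises t(cosh(κs) - 1)/s² - κN, whose derivative vanishes when sinh(κs) = sN/t.
    have := G.norm_inner_semigroup_le_exp hpos hclos hd hs_pos hs_fin
      (κ := Real.arsinh ((jumpSize G d).toReal * N / t) / (jumpSize G d).toReal)
      (div_nonneg (Real.arsinh_nonneg_iff.2 (by positivity)) hs.le) hN0 ht f g
      (ENNReal.ofReal_toReal htop).le
    rwa [exponent_arsinh_eq hs ht] at this

theorem norm_heatKernel_le [Nonempty X] (hpos : G.IsPositive) (hclos : G.IsClosable)
    (hd : IsIntrinsicMetric G d) (hs_pos : 0 < jumpSize G d) (hs_fin : jumpSize G d < ∞)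
    {t : ℝ} (ht : 0 < t) (x y : X) :
    ‖G.heatKernel t x y‖ ≤
      dggBound G.bottom t (jumpSize G d).toReal (d x y) / √(G.m x * G.m y) := by
  have hsupp : ∀ z : X, Function.support (G.incl (Finsupp.single z 1)) = {z} := fun z => by
    rw [coe_incl]
    ext w
    simp
  have h := G.norm_inner_semigroup_le hpos hclos hd hs_pos hs_fin ht
    (G.incl (Finsupp.single x 1)) (G.incl (Finsupp.single y 1))
  have hdist : setDist d {x} {y} = d x y := by simp [setDist]
  rw [hsupp, hsupp, hdist, norm_incl_single, norm_incl_single, mul_assoc,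
    ← Real.sqrt_mul (G.m_pos x).le] at h
  have hm : 0 < G.m x * G.m y := mul_pos (G.m_pos x) (G.m_pos y)
  rw [heatKernel, norm_div, ← Complex.ofReal_mul, Complex.norm_real, Real.norm_of_nonneg hm.le,
    div_le_div_iff₀ hm (Real.sqrt_pos.2 hm)]
  calc _ ≤ _ * √(G.m x * G.m y) * √(G.m x * G.m y) := by gcongr
    _ = _ := by rw [mul_assoc, Real.mul_self_sqrt hm.le]

end MagneticSchrodingerGraph

theorem theorem2p2 {X : Type*} [MeasurableSpace X] [DiscreteMeasurableSpace X]
    (G : MagneticSchrodingerGraph X) (hpos : G.IsPositive) (hclos : G.IsClosable)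
    (d : X → X → ℝ≥0∞) (hd : IsIntrinsicMetric G d)
    (hs_pos : 0 < jumpSize G d) (hs_fin : jumpSize G d < ∞) :
    (∀ t : ℝ, 0 < t → ∀ f g : G.L2,
      ‖inner ℂ g (G.semigroup t f)‖ ≤
        dggBound G.bottom t (jumpSize G d).toReal
          (setDist d (Function.support f) (Function.support g)) * ‖f‖ * ‖g‖) ∧
    (∀ t : ℝ, 0 < t → ∀ x y : X,
      ‖G.heatKernel t x y‖ ≤
        dggBound G.bottom t (jumpSize G d).toReal (d x y) / √(G.m x * G.m y)) := by
  -- On an empty X the supremum defining the jump size is 0. A point is needed for J ≠ 0.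
  have : Nonempty X := by
    by_contra h
    rw [not_nonempty_iff] at h
    simp [jumpSize] at hs_pos
  exact ⟨fun t ht f g => G.norm_inner_semigroup_le hpos hclos hd hs_pos hs_fin ht f g,
    fun t ht x y => G.norm_heatKernel_le hpos hclos hd hs_pos hs_fin ht x y⟩
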